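/- Let $F$ be a connected, closed, oriented surface and let $D=\pi(L)\subset F$ be a non-empty link diagram on $F$. A Kauffman state $s$ of $D$ is a choice of the $A$ or the $B$ resolution at every crossing; let $a(s)$, $b(s)$ be the numbers of $A$ and $B$ resolutions in $s$, and let $|s|$ be the number of state circles, i.e. of the simple closed curves on $F$ that result from $D$ by applying $s$. Put $$\langle D\rangle_0=\sum_{s} A^{a(s)-b(s)}(-A^2-A^{-2})^{|s|-1},$$ where the sum is over the states $s$ all of whose state circles are contractible on $F$, and let $J_0(D)\in\mathbb Z[t^{1/4},t^{-1/4}]$ be $\langle D\rangle_0$ or, for an oriented link with writhe $w(D)$, $(-1)^{w(D)}A^{-3w(D)}\langle D\rangle_0$, in the variable $t=A^4$. Let $m$ and $n$ be the highest and the lowest degree of $J_0(D)$ in $t$ (in $\tfrac14\mathbb Z$), and let $a_m,a_{m-1},b_{n+1},b_n$ be the coefficients of $t^m,t^{m-1},t^{n+1},t^n$ in $J_0(D)$. Let $s_A$ and $s_B$ be the all-$A$ and the all-$B$ state. The state graph $G_A$ has the state circles of $s_A$ as vertices and the crossings of $D$ as edges, each edge joining the arcs of state circles that result from resolving its crossing.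 The diagram $D$ is geometrically $A$-adequate if all state circles of $s_A$ are contractible on $F$ and $G_A$ has no 1-edge loops. In this case let $e'_A$ be the number of edges of the reduced graph $G'_A$, obtained from $G_A$ by identifying two edges $e_1,e_2$ whenever they join the same two vertices and $e_1\cup e_2$ (closed up by arcs of the two state circles) bounds a disk on $F$. Define $G_B$, geometric $B$-adequacy and $e'_B$ in the same way from $s_B$. 1. If $D$ is geometrically $A$-adequate, then $J_0(D)\neq 0$, $|a_m|=1$ and $|a_{m-1}|=\bigl|\,e'_A-|s_A|+1\,\bigr|$; if moreover $D$ is connected (for instance, if all regions of $F\setminus D$ are disks), then $|a_{m-1}|=e'_A-|s_A|+1$. 2. If $D$ is geometrically $B$-adequate, then $J_0(D)\neq 0$, $|b_n|=1$ and $|b_{n+1}|=\bigl|\,e'_B-|s_B|+1\,\bigr|$; if moreover $D$ is connected, then $|b_{n+1}|=e'_B-|s_B|+1$. -/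

import Mathlib

open scoped LaurentPolynomial

noncomputable section

/-! ## Closed oriented surfaces -/

/-- A connected closed oriented surface `F`, given by a finite cell decomposition, recorded as usual
by the rotation system of its 1-skeleton.  `H` is the set of half-edges.  A half-edge `d` is attached
to one vertex and is also read as the edge oriented away from that vertex.  `opp d` is the other half
of the edge of `d` (the same edge with the opposite orientation), and `next d` is the half-edge that
follows `d` counterclockwise around the vertex of `d`.  The vertices are the orbits of `next`, the
faces (open disks) are the orbits of `faceNext`. -/
structure ClosedSurface (H : Type*) where
  next : Equiv.Perm H
  opp : Equiv.Perm H
  opp_opp : ∀ d, opp (opp d) = d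
  opp_ne : ∀ d, opp d ≠ d
  connected : ∀ d e : H, ∃ g ∈ Subgroup.closure ({next, opp} : Set (Equiv.Perm H)), g d = e

namespace ClosedSurface

variable {H : Type*} (F : ClosedSurface H)

/-- Two half-edges are attached to the same vertex of the cell decomposition. -/
def SameVertex (d e : H) : Prop := F.next.SameCycle d e

/-- The next edge along the boundary of the face on the left of the oriented edge `d`. -/
def faceNext : Equiv.Perm H := F.opp.trans F.next.symm

/-- The boundary walk of the face on the left of `d`, starting with `d`. -/
def faceWalk (d : H) : List H :=
  List.iterate F.faceNext d (Function.minimalPeriod F.faceNext d)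

/-- The relations for homotopy of edge walks: going along an edge and back, and going once around a
face, are trivial. -/
def homotopyRels : Set (FreeGroup H) :=
  Set.range (fun d => FreeGroup.of d * FreeGroup.of (F.opp d)) ∪
    Set.range (fun d => ((F.faceWalk d).map FreeGroup.of).prod)

/-- The edge-path group: words in the oriented edges, up to deleting or inserting a backtrack or the
boundary walk of a face.  It is the fundamental group of the space obtained from `F` by gluing all
vertices to one point, i.e. the free product of the fundamental group of `F` with a free group; for
every vertex `v`, the classes of the closed walks at `v` form a copy of `π₁(F, v)`. -/
abbrev EdgePathGroup := PresentedGroup F.homotopyRels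

/-- A closed edge walk in the surface is contractible (null-homotopic). If the curve is simple, this
means that it bounds a disk. -/
def Contractible (w : List H) : Prop :=
  (w.map (PresentedGroup.of (rels := F.homotopyRels))).prod = 1

end ClosedSurface

/-! ## Link diagrams -/

/-- A link diagram `D` on the surface `F`, as a subcomplex of the cell decomposition.  `C` is the set
of crossings and `P` is the set of the other vertices of the cell decomposition that lie on `D`.
The half-edges of `D` at the crossing `i` are `half (inl (i, k))`, `k = 0, 1, 2, 3`, in
counterclockwise order, where `k = 0, 2` is the over-strand and `k = 1, 3` is the under-strand; there
are no other half-edges of the cell decomposition at a crossing.  The two half-edges of `D` at the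
regular point `p` are `half (inr (p, k))`, `k = 0, 1`; here the cell decomposition may have further
half-edges, which do not belong to `D`.  (So the regions of `D` need not be disks, and `D` may have
components without crossings.)  `mate` matches the two halves of every edge of `D`. -/
structure LinkDiagram {H : Type*} (F : ClosedSurface H) (C P : Type*) where
  half : (C × ZMod 4) ⊕ (P × ZMod 2) → H
  half_injective : Function.Injective half
  next_crossing : ∀ i k, F.next (half (Sum.inl (i, k))) = half (Sum.inl (i, k + 1))
  sameVertex_point : ∀ p, F.SameVertex (half (Sum.inr (p, 0))) (half (Sum.inr (p, 1)))
  point_injective : ∀ p q, F.SameVertex (half (Sum.inr (p, 0))) (half (Sum.inr (q, 0))) → p = q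
  mate : (C × ZMod 4) ⊕ (P × ZMod 2) → (C × ZMod 4) ⊕ (P × ZMod 2)
  half_mate : ∀ x, half (mate x) = F.opp (half x)

/-- A Kauffman state: the choice of a resolution at every crossing, `true` for the `A` resolution and
`false` for the `B` resolution. -/
abbrev KauffmanState (C : Type*) := C → Bool

namespace LinkDiagram

variable {H C P : Type*} {F : ClosedSurface H} (D : LinkDiagram F C P)

/-- The half-edges of the diagram. -/
abbrev HalfEdge (_ : LinkDiagram F C P) := (C × ZMod 4) ⊕ (P × ZMod 2)

/-- The vertex (crossing or regular point) of a half-edge of the diagram. -/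
def vertex (x : D.HalfEdge) : C ⊕ P := Sum.map Prod.fst Prod.fst x

/-- The diagram is non-empty and connected (as a subset of the surface). -/
def Connected : Prop :=
  Nonempty D.HalfEdge ∧
    ∀ x y, Relation.EqvGen (fun u v => v = D.mate u ∨ D.vertex u = D.vertex v) x y

/-! ### States and state circles -/

/-- How a half-edge continues through its vertex after the resolutions of the state `s`.
The `A` resolution joins the two regions that the over-strand sweeps out when it is rotated
counterclockwise (those between `0` and `1` and between `2` and `3`), so it connects `0` with `3` and
`1` with `2`; the `B` resolution connects `0` with `1` and `2` with `3`. -/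
def turn (s : KauffmanState C) : D.HalfEdge → D.HalfEdge
  | Sum.inl (i, k) => Sum.inl (i, if s i then 3 - k else 1 - k)
  | Sum.inr (p, k) => Sum.inr (p, k + 1)

/-- Travelling along a state circle: from the oriented edge `x` to the next oriented edge. -/
def step (s : KauffmanState C) (x : D.HalfEdge) : D.HalfEdge := D.turn s (D.mate x)

/-- The state circles of `s`: the half-edges up to the relation generated by
passing to the other half of an edge and by passing through a vertex along the resolution. -/
def Circle (s : KauffmanState C) : Type _ :=
  Quot (fun x y : D.HalfEdge => y = D.mate x ∨ y = D.turn s x)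

/-- The state circle of a half-edge. -/
def circle (s : KauffmanState C) (x : D.HalfEdge) : D.Circle s := Quot.mk _ x

/-- `|s|`, the number of state circles. -/
def numCircles (s : KauffmanState C) : ℕ := Nat.card (D.Circle s)

/-- The arc of a state circle that starts with the oriented edge `x` and consists of `m` edges, as an
edge walk in the surface. -/
def arc (s : KauffmanState C) (x : D.HalfEdge) (m : ℕ) : List H :=
  (List.iterate (D.step s) x m).map D.half

/-- The state circle through `x`, travelled once, as a closed edge walk in the surface. -/
def circleWalk (s : KauffmanState C) (x : D.HalfEdge) : List H :=
  D.arc s x (Function.minimalPeriod (D.step s) x)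

/-- All state circles of `s` are contractible on the surface (`s_nt = ∅`). -/
def AllContractible (s : KauffmanState C) : Prop :=
  ∀ x, F.Contractible (D.circleWalk s x)

/-- The all-`A` state. -/
def stateA (_ : LinkDiagram F C P) : KauffmanState C := fun _ => true

/-- The all-`B` state. -/
def stateB (_ : LinkDiagram F C P) : KauffmanState C := fun _ => false

/-! ### The bracket and the Jones polynomial -/

open Classical in
/-- The Kauffman bracket `⟨D⟩₀`, a Laurent polynomial in the variable `A`: the sum over the states
`s` all of whose circles are contractible of `A ^ (a(s) - b(s)) * (-A ^ 2 - A ^ (-2)) ^ (|s| - 1)`. -/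
def bracket [Fintype C] : ℤ[T;T⁻¹] :=
  ∑ s : KauffmanState C, if D.AllContractible s then
    LaurentPolynomial.T (∑ i, if s i then (1 : ℤ) else -1) *
      (-LaurentPolynomial.T 2 - LaurentPolynomial.T (-2)) ^ (D.numCircles s - 1)
  else 0

/-- An orientation of the link: `out x` says that the link runs along the half-edge `x` away from
its vertex.  Each strand runs straight through each vertex. -/
structure Orientation where
  out : D.HalfEdge → Bool
  out_mate : ∀ x, out (D.mate x) = !out x
  out_crossing : ∀ i k, out (Sum.inl (i, k + 2)) = !out (Sum.inl (i, k))
  out_point : ∀ p k, out (Sum.inr (p, k + 1)) = !out (Sum.inr (p, k))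

/-- The writhe. A crossing is positive iff the direction of the over-strand, rotated by a
quarter turn counterclockwise, is the direction of the under-strand. -/
def writhe [Fintype C] (o : D.Orientation) : ℤ :=
  ∑ i : C, if o.out (Sum.inl (i, 0)) = o.out (Sum.inl (i, 1)) then 1 else -1

/-- The polynomial `J₀ = (-1) ^ w(D) * A ^ (-3 * w(D)) * ⟨D⟩₀`, where `t = A ^ 4`, so that the
coefficient of `t ^ r` is the coefficient of `A ^ (4 * r)`. -/
def jones [Fintype C] (o : D.Orientation) : ℤ[T;T⁻¹] :=
  LaurentPolynomial.C ((D.writhe o).negOnePow : ℤ) * LaurentPolynomial.T (-3 * D.writhe o) * D.bracket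

/-! ### State graphs and geometric adequacy -/

/-- The state graph `G_s` has the state circles as vertices and the crossings as edges; this is the
pair of ends of the edge `i`. Half-edges `0` and `2` lie on different arcs of the
resolved crossing, for both resolutions. -/
def ends (s : KauffmanState C) (i : C) : Sym2 (D.Circle s) :=
  s(D.circle s (Sum.inl (i, 0)), D.circle s (Sum.inl (i, 2)))

/-- All circles of `s` are contractible and `G_s` has no 1-edge loops. For the all-`A` state this
is geometric `A`-adequacy, for the all-`B` state it is geometric `B`-adequacy. -/
def GeometricallyAdequate (s : KauffmanState C) : Prop :=
  D.AllContractible s ∧ ∀ i, ¬ (D.ends s i).IsDiag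

/-- The edges `i`, `j` of `G_s` join the same two circles, and `i ∪ j`
bounds a disk on the surface: the closed curve that runs along an arc of one of the two circles from
`i` to `j`, crosses over along `j`, returns along an arc of the other circle from `j` to `i`,
and crosses back along `i`, is contractible.  (An edge of `G_s` lies within the crossing point, so it
adds nothing to the edge walk; when the circles of `s` are contractible, the choice of the arcs does
not matter.) -/
def Parallel (s : KauffmanState C) (i j : C) : Prop :=
  ∃ (k l k' l' : ZMod 4) (m n : ℕ),
    (D.step s)^[m] (Sum.inl (i, k)) = Sum.inl (j, l) ∧
    (D.step s)^[n] (Sum.inl (j, l')) = Sum.inl (i, k') ∧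
    D.circle s (Sum.inl (i, k)) ≠ D.circle s (Sum.inl (j, l')) ∧
    F.Contractible (D.arc s (Sum.inl (i, k)) m ++ D.arc s (Sum.inl (j, l')) n)

/-- `e'_s`, the number of edges of the reduced graph `G'_s`, in which parallel edges are
identified. -/
def numReducedEdges (s : KauffmanState C) : ℕ := Nat.card (Quot (D.Parallel s))

end LinkDiagram

end

/-! Record a state by the set `S` of crossings where it differs from the constant state `s_A`. Its
term has top degree `|C| - 2|S| + 2(|s| - 1)` in `A`. One change of resolution alters `|s|` by at
most one, and the first change away from an adequate state merges two circles. So every term with `S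
≠ ∅` stays at least 4 below the top degree of the term of `s_A` (`numCircles_off_le`), and the
leading coefficient is `±1`.

Four degrees lower (one power of `t`), the term of `s_A` contributes `±(|s_A| - 1)` by the binomial
expansion. Every extremal `S` (contractible circles, equality in the bound) contributes the same
sign times `(-1)^|S|`. The core is that a non-empty `S` is extremal exactly when its crossings are
pairwise parallel (`IsExtremal.parallel`, `isExtremal_of_parallel`). The non-empty subsets of one
parallel class have signed count `-1`, so the coefficient is `±(|s_A| - 1 - e'_A)`. For connected
`D` the state graph is connected, which fixes the sign of this number.

The topology enters through two devices. A potential integrates the classes of edges along the state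
circles; it exists iff all circles are contractible, it survives a change of resolution at a
crossing where it is constant, and it detects parallel edges (`parallel_iff`). A colouring expresses
that a contractible circle separates `F` modulo 2; it excludes reconnecting one contractible circle
to a single circle, and it places parallel crossings on one side of a circle (`isLoop_off`).

A constant state `b` treats both cases at once: for `b = false`, `A` is replaced by `A⁻¹`. -/

noncomputable section

namespace LinkDiagram

variable {H C P : Type*} {F : ClosedSurface H} (D : LinkDiagram F C P)

/-! ### Edges and turns -/

theorem mate_mate (x : D.HalfEdge) : D.mate (D.mate x) = x :=
  D.half_injective (by rw [D.half_mate, D.half_mate, F.opp_opp])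

theorem mate_ne (x : D.HalfEdge) : D.mate x ≠ x := fun h =>
  F.opp_ne (D.half x) (by rw [← D.half_mate, h])

theorem turn_turn (s : KauffmanState C) (x : D.HalfEdge) : D.turn s (D.turn s x) = x := by
  rcases x with ⟨i, k⟩ | ⟨p, k⟩
  · by_cases h : s i <;> simp [turn, h]
  · have : k + 1 + 1 = k := by revert k; decide
    simp [turn, this]

theorem turn_ne (s : KauffmanState C) (x : D.HalfEdge) : D.turn s x ≠ x := by
  rcases x with ⟨i, k⟩ | ⟨p, k⟩
  · by_cases h : s i
    · have : 3 - k ≠ k := by revert k; decide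
      simpa [turn, h] using this
    · have : 1 - k ≠ k := by revert k; decide
      simpa [turn, h] using this
  · simp [turn]

theorem vertex_turn (s : KauffmanState C) (x : D.HalfEdge) :
    D.vertex (D.turn s x) = D.vertex x := by
  rcases x with ⟨i, k⟩ | ⟨p, k⟩ <;> rfl

theorem vertex_eq_inl {x : D.HalfEdge} {i : C} (h : D.vertex x = Sum.inl i) :
    ∃ k, x = Sum.inl (i, k) := by
  rcases x with ⟨j, k⟩ | ⟨p, k⟩
  · obtain rfl : j = i := by simpa [vertex] using h
    exact ⟨k, rfl⟩
  · simp [vertex] at h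

theorem turn_inl_ne_add_two (s : KauffmanState C) (i : C) (k : ZMod 4) :
    D.turn s (Sum.inl (i, k)) ≠ Sum.inl (i, k + 2) := by
  by_cases h : s i
  · have : 3 - k ≠ k + 2 := by revert k; decide
    simpa [turn, h] using this
  · have : 1 - k ≠ k + 2 := by revert k; decide
    simpa [turn, h] using this

theorem turn_step (s : KauffmanState C) (x : D.HalfEdge) :
    D.turn s (D.step s x) = D.mate x := D.turn_turn s _

theorem step_mate_turn (s : KauffmanState C) (x : D.HalfEdge) :
    D.step s (D.mate (D.turn s x)) = x := by
  rw [step, mate_mate, turn_turn]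

theorem step_injective (s : KauffmanState C) : Function.Injective (D.step s) := fun x y h => by
  rw [← D.mate_mate x, ← D.mate_mate y, ← turn_step D s x, ← turn_step D s y, h]

/-- A state circle is not travelled in both directions. -/
theorem step_iterate_ne_turn (s : KauffmanState C) (n : ℕ) (x : D.HalfEdge) :
    (D.step s)^[n] x ≠ D.turn s x := by
  induction n using Nat.strong_induction_on generalizing x with
  | _ n ih =>
    intro h
    match n, h with
    | 0, h => exact D.turn_ne s x h.symm
    | 1, h =>
      have := congrArg (D.turn s) (show D.turn s (D.mate x) = D.turn s x from h)
      rw [turn_turn, turn_turn] at this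
      exact D.mate_ne x this
    -- Peeling off one step at each end turns a reversal at `x` into a reversal at `step x` that is
    -- two steps shorter. The induction ends at a fixed point of `turn` or of `mate`.
    | n + 2, h =>
      refine ih n (by omega) (D.step s x) ?_
      rw [turn_step, ← Function.iterate_succ_apply]
      apply D.step_injective s
      rw [← Function.iterate_succ_apply' (D.step s), h, step, mate_mate]

theorem step_iterate_ne_mate (s : KauffmanState C) (n : ℕ) (x : D.HalfEdge) :
    (D.step s)^[n] x ≠ D.mate x := by
  intro h
  rw [← turn_step D s x] at h
  cases n with
  | zero => exact D.mate_ne x (by rw [← turn_step D s x]; exact h.symm)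
  | succ n =>
    exact D.step_iterate_ne_turn s n (D.step s x) (by rw [← h, Function.iterate_succ_apply])

/-! ### State circles -/

theorem circle_mate (s : KauffmanState C) (x : D.HalfEdge) :
    D.circle s (D.mate x) = D.circle s x :=
  (Quot.sound (r := fun x y : D.HalfEdge => y = D.mate x ∨ y = D.turn s x) (Or.inl rfl)).symm

theorem circle_turn (s : KauffmanState C) (x : D.HalfEdge) :
    D.circle s (D.turn s x) = D.circle s x :=
  (Quot.sound (r := fun x y : D.HalfEdge => y = D.mate x ∨ y = D.turn s x) (Or.inr rfl)).symm

theorem circle_step (s : KauffmanState C) (x : D.HalfEdge) :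
    D.circle s (D.step s x) = D.circle s x := by rw [step, circle_turn, circle_mate]

theorem circle_iterate (s : KauffmanState C) (n : ℕ) (x : D.HalfEdge) :
    D.circle s ((D.step s)^[n] x) = D.circle s x := by
  induction n generalizing x with
  | zero => rfl
  | succ n ih => rw [Function.iterate_succ_apply, ih, circle_step]

/-- A property that is preserved along a state circle holds on the circle if it holds once. -/
theorem circle_induction {s : KauffmanState C} {p : D.HalfEdge → Prop}
    (hm : ∀ x, p x → p (D.mate x)) (ht : ∀ x, p x → p (D.turn s x)) {x y : D.HalfEdge}
    (h : D.circle s x = D.circle s y) (hx : p x) : p y := by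
  have hm' : ∀ x, p (D.mate x) = p x := fun x =>
    propext ⟨fun h => by simpa only [mate_mate] using hm _ h, hm x⟩
  have ht' : ∀ x, p (D.turn s x) = p x := fun x =>
    propext ⟨fun h => by simpa only [turn_turn] using ht _ h, ht x⟩
  let q : D.Circle s → Prop := Quot.lift p (by
    rintro a b (rfl | rfl)
    · exact (hm' a).symm
    · exact (ht' a).symm)
  have : q (D.circle s x) = q (D.circle s y) := by rw [h]
  exact this.mp hx

theorem eq_of_circle_eq {s : KauffmanState C} {α : Type*} {θ : D.HalfEdge → α}
    (hm : ∀ x, θ (D.mate x) = θ x) (ht : ∀ x, θ (D.turn s x) = θ x) {x y : D.HalfEdge}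
    (h : D.circle s x = D.circle s y) : θ x = θ y :=
  D.circle_induction (p := fun y => θ x = θ y) (fun y hy => hy.trans (hm y).symm)
    (fun y hy => hy.trans (ht y).symm) h rfl

theorem circle_surjective (s : KauffmanState C) : Function.Surjective (D.circle s) :=
  Quot.exists_rep

section Finite

variable [Finite C] [Finite P]

theorem mem_periodicPts_step (s : KauffmanState C) (x : D.HalfEdge) :
    x ∈ Function.periodicPts (D.step s) :=
  (D.step_injective s).mem_periodicPts x

theorem minimalPeriod_step_pos (s : KauffmanState C) (x : D.HalfEdge) :
    0 < Function.minimalPeriod (D.step s) x :=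
  Function.minimalPeriod_pos_of_mem_periodicPts (D.mem_periodicPts_step s x)

theorem exists_iterate_symm (s : KauffmanState C) (x : D.HalfEdge) (n : ℕ) :
    ∃ m, (D.step s)^[m] ((D.step s)^[n] x) = x := by
  have hp := D.minimalPeriod_step_pos s x
  -- Together with the `n` steps already made this is `n` full periods; the subtraction is not
  -- truncated because the period is positive.
  refine ⟨n * Function.minimalPeriod (D.step s) x - n, ?_⟩
  rw [← Function.iterate_add_apply, Nat.sub_add_cancel (Nat.le_mul_of_pos_right n hp)]
  exact (Function.isPeriodicPt_minimalPeriod (D.step s) x).const_mul n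

/-- A state circle through `x` is travelled by starting with `x`, in one of the two directions. -/
theorem exists_iterate_of_circle_eq {s : KauffmanState C} {x y : D.HalfEdge}
    (h : D.circle s x = D.circle s y) :
    (∃ n, (D.step s)^[n] x = y) ∨ ∃ n, (D.step s)^[n] x = D.mate y := by
  have hback : ∀ y n, (D.step s)^[n] x = D.step s y → ∃ n, (D.step s)^[n] x = y := by
    intro y n hn
    obtain ⟨m, hm⟩ := D.exists_iterate_symm s y 1
    refine ⟨m + n, ?_⟩
    rw [Function.iterate_add_apply, hn]
    exact hm
  refine D.circle_induction (p := fun y => (∃ n, (D.step s)^[n] x = y) ∨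
    ∃ n, (D.step s)^[n] x = D.mate y) ?_ ?_ h (Or.inl ⟨0, rfl⟩)
  · rintro y (⟨n, hn⟩ | ⟨n, hn⟩)
    · exact Or.inr ⟨n, by rw [mate_mate, hn]⟩
    · exact Or.inl ⟨n, hn⟩
  · rintro y (⟨n, hn⟩ | ⟨n, hn⟩)
    · refine Or.inr (hback _ n ?_)
      rw [hn, step_mate_turn]
    · refine Or.inl ⟨n + 1, ?_⟩
      rw [Function.iterate_succ_apply', hn, step, mate_mate]

theorem exists_iterate_or_turn {s : KauffmanState C} {x y : D.HalfEdge}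
    (h : D.circle s x = D.circle s y) :
    ∃ n, (D.step s)^[n] x = y ∨ (D.step s)^[n] x = D.turn s y := by
  rcases D.exists_iterate_of_circle_eq h with ⟨n, hn⟩ | ⟨n, hn⟩
  · exact ⟨n, Or.inl hn⟩
  · exact ⟨n + 1, Or.inr (by rw [Function.iterate_succ_apply', hn, step, mate_mate])⟩

end Finite

/-! ### Contractible circles and potentials -/

/-- The class of a half-edge of the diagram in the edge-path group. -/
def cls (x : D.HalfEdge) : F.EdgePathGroup := PresentedGroup.of (D.half x)

theorem cls_mul_cls_mate (x : D.HalfEdge) : D.cls x * D.cls (D.mate x) = 1 := by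
  rw [cls, cls, D.half_mate]
  exact PresentedGroup.one_of_mem (Or.inl ⟨D.half x, rfl⟩)

/-- The class of an arc of a state circle in the edge-path group. -/
def arcClass (s : KauffmanState C) (x : D.HalfEdge) (m : ℕ) : F.EdgePathGroup :=
  ((D.arc s x m).map (PresentedGroup.of (rels := F.homotopyRels))).prod

theorem arcClass_zero (s : KauffmanState C) (x : D.HalfEdge) : D.arcClass s x 0 = 1 := rfl

theorem arcClass_add (s : KauffmanState C) (x : D.HalfEdge) (m n : ℕ) :
    D.arcClass s x (m + n) = D.arcClass s x m * D.arcClass s ((D.step s)^[m] x) n := by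
  simp only [arcClass, arc, List.iterate_add, List.map_append, List.prod_append]

theorem arcClass_succ (s : KauffmanState C) (x : D.HalfEdge) (m : ℕ) :
    D.arcClass s x (m + 1) = D.arcClass s x m * D.cls ((D.step s)^[m] x) := by
  rw [arcClass_add]
  simp [arcClass, arc, cls]

/-- A potential of a state: a function on the half-edges whose increments along the
state circles are the classes in the edge-path group. -/
structure IsPotential (s : KauffmanState C) (φ : D.HalfEdge → F.EdgePathGroup) : Prop where
  turn : ∀ x, φ (D.turn s x) = φ x
  mate : ∀ x, φ (D.mate x) = φ x * D.cls x

namespace IsPotential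

variable {D} {s : KauffmanState C} {φ : D.HalfEdge → F.EdgePathGroup}

theorem iterate (h : D.IsPotential s φ) (x : D.HalfEdge) (n : ℕ) :
    φ ((D.step s)^[n] x) = φ x * D.arcClass s x n := by
  induction n with
  | zero => simp [arcClass_zero]
  | succ n ih =>
    rw [Function.iterate_succ_apply', step, h.turn, h.mate, ih, arcClass_succ, mul_assoc]

theorem allContractible (h : D.IsPotential s φ) : D.AllContractible s := fun x => by
  have := h.iterate x (Function.minimalPeriod (D.step s) x)
  rw [Function.iterate_minimalPeriod, left_eq_mul] at this
  exact this

/-- A potential may be translated on every circle. -/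
theorem gauge (h : D.IsPotential s φ) (g : D.Circle s → F.EdgePathGroup) :
    D.IsPotential s (fun x => g (D.circle s x) * φ x) where
  turn x := by rw [circle_turn, h.turn]
  mate x := by rw [circle_mate, h.mate, mul_assoc]

end IsPotential

/-- Choose a base half-edge on every circle and integrate from there. The value depends only on the
end point because a full turn has trivial class. -/
theorem AllContractible.exists_isPotential [Finite C] [Finite P] {D : LinkDiagram F C P}
    {s : KauffmanState C} (h : D.AllContractible s) : ∃ φ, D.IsPotential s φ := by
  classical
  have hwd : ∀ x m n, (D.step s)^[m] x = (D.step s)^[m + n] x →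
      D.arcClass s x m = D.arcClass s x (m + n) := by
    intro x m n hmn
    rw [arcClass_add]
    set y := (D.step s)^[m] x with hy
    have hy' : (D.step s)^[n] y = y := by
      rw [hy, ← Function.iterate_add_apply, Nat.add_comm n m]; exact hmn.symm
    obtain ⟨q, rfl⟩ := Function.IsPeriodicPt.minimalPeriod_dvd hy'
    suffices D.arcClass s y (Function.minimalPeriod (D.step s) y * q) = 1 by rw [this, mul_one]
    clear hmn hy'
    clear_value y
    induction q with
    | zero => rfl
    | succ q ih =>
      rw [Nat.mul_succ, arcClass_add, ih, one_mul,
        (Function.isPeriodicPt_minimalPeriod (D.step s) y).mul_const q]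
      exact h y
  have hwd' : ∀ x m n, (D.step s)^[m] x = (D.step s)^[n] x →
      D.arcClass s x m = D.arcClass s x n := by
    intro x m n hmn
    rcases le_total m n with hl | hl
    · obtain ⟨k, rfl⟩ := Nat.exists_eq_add_of_le hl
      exact hwd x m k hmn
    · obtain ⟨k, rfl⟩ := Nat.exists_eq_add_of_le hl
      exact (hwd x n k hmn.symm).symm
  choose r hr using D.circle_surjective s
  let R : D.HalfEdge → D.HalfEdge := fun x => r (D.circle s x)
  have hex : ∀ x, ∃ n, (D.step s)^[n] (R x) = x ∨ (D.step s)^[n] (R x) = D.turn s x := fun x =>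
    D.exists_iterate_or_turn (hr _)
  choose N hN using hex
  -- Starting from `R x`, one meets `x` or `turn s x` but never both, since a circle is not
  -- travelled in both directions. So the arc class does not depend on the chosen `N x`.
  have key : ∀ x n, ((D.step s)^[n] (R x) = x ∨ (D.step s)^[n] (R x) = D.turn s x) →
      D.arcClass s (R x) (N x) = D.arcClass s (R x) n := by
    intro x n hn
    have hcross : ∀ m n, (D.step s)^[m] (R x) = x → (D.step s)^[n] (R x) = D.turn s x → False := by
      intro m n hm hn
      obtain ⟨l, hl⟩ := D.exists_iterate_symm s (R x) m
      apply D.step_iterate_ne_turn s (n + l) x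
      rw [Function.iterate_add_apply, ← hn]
      rw [hm] at hl
      rw [hl]
    apply hwd'
    rcases hn with hn | hn <;> rcases hN x with hx | hx
    · rw [hn, hx]
    · exact (hcross _ _ hn hx).elim
    · exact (hcross _ _ hx hn).elim
    · rw [hn, hx]
  have hRm : ∀ x, R (D.mate x) = R x := fun x => by simp only [R, circle_mate]
  have hRt : ∀ x, R (D.turn s x) = R x := fun x => by simp only [R, circle_turn]
  have hstep : ∀ x n, (D.step s)^[n] (R x) = x →
      D.arcClass s (R x) (N (D.mate x)) = D.arcClass s (R x) (N x) * D.cls x := by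
    intro x n hn
    rw [key x n (Or.inl hn), ← hRm, key (D.mate x) (n + 1), hRm, arcClass_succ, hn]
    right
    rw [hRm, Function.iterate_succ_apply', hn, step]
  refine ⟨fun x => D.arcClass s (R x) (N x), ⟨fun x => ?_, fun x => ?_⟩⟩
  · refine (key _ _ ?_).trans (by rw [hRt])
    rw [hRt, turn_turn]
    exact (hN x).symm
  · simp only [hRm]
    rcases D.exists_iterate_of_circle_eq (hr (D.circle s x)) with ⟨n, hn⟩ | ⟨n, hn⟩
    · exact hstep x n hn
    -- Here the circle runs against `x`; the relation for `mate x` is inverted.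
    · have h1 := hstep (D.mate x) n (by rw [hRm]; exact hn)
      rw [mate_mate, hRm] at h1
      rw [h1, mul_assoc]
      have h2 := D.cls_mul_cls_mate (D.mate x)
      rw [mate_mate] at h2
      rw [h2, mul_one]

end LinkDiagram

/-! ### Contractible walks and boundaries modulo 2 -/

namespace ClosedSurface

variable {H : Type*} (F : ClosedSurface H)

theorem faceNext_opp (d : H) : F.faceNext (F.opp d) = F.next.symm d := by
  simp [faceNext, F.opp_opp]

open Classical in
/-- The edge of `d`, as a chain modulo 2. -/
def edgeChain (d e : H) : ZMod 2 := (if d = e then 1 else 0) + if F.opp d = e then 1 else 0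

theorem opp_eq_iff (d e : H) : F.opp d = e ↔ d = F.opp e :=
  ⟨fun h => by rw [← h, F.opp_opp], fun h => by rw [h, F.opp_opp]⟩

theorem edgeChain_opp (d : H) : F.edgeChain (F.opp d) = F.edgeChain d := by
  funext e
  unfold edgeChain
  rw [add_comm]
  congr 2
  exact propext (by rw [F.opp_opp])

/-- The boundaries modulo 2 of sets of faces. -/
def boundaries : AddSubgroup (H → ZMod 2) where
  carrier := {v | ∃ g : H → ZMod 2, (∀ d, g (F.faceNext d) = g d) ∧ ∀ d, v d = g d + g (F.opp d)}
  zero_mem' := ⟨0, by simp, by simp⟩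
  add_mem' := by
    rintro v w ⟨g, hg, hv⟩ ⟨g', hg', hw⟩
    refine ⟨g + g', fun d => by simp [hg, hg'], fun d => ?_⟩
    simp only [Pi.add_apply, hv, hw]
    ring
  neg_mem' := by
    rintro v ⟨g, hg, hv⟩
    refine ⟨-g, fun d => by simp [hg], fun d => ?_⟩
    simp only [Pi.neg_apply, hv]
    ring

open Classical in
theorem faceWalk_mem_boundaries (d : H) :
    ((F.faceWalk d).map F.edgeChain).sum ∈ F.boundaries := by
  set p := Function.minimalPeriod F.faceNext d with hp
  have hper : F.faceNext^[p] d = d := Function.iterate_minimalPeriod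
  have hsum : ((F.faceWalk d).map F.edgeChain).sum =
      ∑ j ∈ Finset.range p, F.edgeChain (F.faceNext^[j] d) := by
    rw [faceWalk, ← List.range_map_iterate, List.map_map, ← hp]
    rfl
  rw [hsum]
  -- The witness is the indicator of the face orbit of `d`. It is invariant under `faceNext` because
  -- shifting the sum by one exchanges its first term for the equal term after a full period.
  refine ⟨fun e => ∑ j ∈ Finset.range p, if F.faceNext^[j] d = e then 1 else 0, fun e => ?_,
    fun e => ?_⟩
  · have h1 := Finset.sum_range_succ
      (fun j => if F.faceNext^[j] d = F.faceNext e then (1 : ZMod 2) else 0) p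
    rw [Finset.sum_range_succ', hper] at h1
    simp only [Function.iterate_zero_apply] at h1
    refine (add_right_cancel h1).symm.trans ?_
    refine Finset.sum_congr rfl fun j _ => ?_
    simp only [Function.iterate_succ_apply', EmbeddingLike.apply_eq_iff_eq]
  · simp only [Finset.sum_apply, ← Finset.sum_add_distrib, edgeChain, opp_eq_iff]

/-- A contractible closed walk bounds a set of faces modulo 2. -/
theorem Contractible.mem_boundaries {F : ClosedSurface H} {w : List H} (h : F.Contractible w) :
    (w.map F.edgeChain).sum ∈ F.boundaries := by
  -- Chains modulo boundaries form an abelian group in which both kinds of relators vanish, so `f`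
  -- factors through the edge-path group.
  let f : H → Multiplicative ((H → ZMod 2) ⧸ F.boundaries) :=
    fun d => Multiplicative.ofAdd (QuotientAddGroup.mk (F.edgeChain d))
  have hprod : ∀ l : List H, (l.map f).prod =
      Multiplicative.ofAdd (QuotientAddGroup.mk (l.map F.edgeChain).sum) := by
    intro l
    induction l with
    | nil => rfl
    | cons a l ih => rw [List.map_cons, List.prod_cons, ih, List.map_cons, List.sum_cons]; rfl
  have hlift : ∀ l : List H, FreeGroup.lift f (l.map FreeGroup.of).prod = (l.map f).prod := by
    intro l
    rw [map_list_prod, List.map_map]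
    congr 2
    funext d
    simp
  have hrel : ∀ r ∈ F.homotopyRels, FreeGroup.lift f r = 1 := by
    rintro r (⟨d, rfl⟩ | ⟨d, rfl⟩)
    · have : F.edgeChain d + F.edgeChain (F.opp d) = 0 := by
        rw [edgeChain_opp]
        funext e
        exact CharTwo.add_self_eq_zero (F.edgeChain d e)
      have h2 := hlift [d, F.opp d]
      rw [hprod] at h2
      simp only [List.map_cons, List.map_nil, List.prod_cons, List.prod_nil, mul_one,
        List.sum_cons, List.sum_nil, add_zero, this] at h2
      exact h2
    · refine (hlift _).trans ((hprod _).trans ?_)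
      exact congrArg Multiplicative.ofAdd
        ((QuotientAddGroup.eq_zero_iff _).mpr (F.faceWalk_mem_boundaries d))
  have h1 := congrArg (PresentedGroup.toGroup hrel) h
  rw [map_list_prod, List.map_map, map_one] at h1
  have h2 : (w.map f).prod = 1 := by
    rw [← h1]
    congr 2
    funext d
    exact (PresentedGroup.toGroup.of hrel).symm
  rw [hprod] at h2
  exact (QuotientAddGroup.eq_zero_iff _).mp (congrArg Multiplicative.toAdd h2)

end ClosedSurface

/-! ### Two-colourings defined by contractible state circles -/

namespace LinkDiagram

variable {H C P : Type*} {F : ClosedSurface H} (D : LinkDiagram F C P)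

open Classical in
/-- A colouring of the regions by two colours that changes exactly along the state circle `c`:
`f x` is the colour on the left of the oriented edge `x`. -/
structure IsColoring (s : KauffmanState C) (c : D.Circle s) (f : D.HalfEdge → ZMod 2) : Prop where
  mate : ∀ x, f (D.mate x) = f x + if D.circle s x = c then 1 else 0
  face : ∀ i k, f (D.mate (Sum.inl (i, k + 1))) = f (Sum.inl (i, k))
  step : ∀ x, f (D.step s x) = f x

open Classical in
-- One period of the walk meets each edge of the circle exactly once: no half-edge is repeated, and
-- by `step_iterate_ne_mate` no edge is run in both orientations.
theorem sum_edgeChain_circleWalk [Finite C] [Finite P] (s : KauffmanState C) (x₀ x : D.HalfEdge) :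
    ((D.circleWalk s x₀).map F.edgeChain).sum (D.half x) =
      if D.circle s x = D.circle s x₀ then 1 else 0 := by
  set p := Function.minimalPeriod (D.step s) x₀ with hp
  have hsum : ((D.circleWalk s x₀).map F.edgeChain).sum (D.half x) =
      (∑ j ∈ Finset.range p, if (D.step s)^[j] x₀ = x then 1 else 0) +
      ∑ j ∈ Finset.range p, if (D.step s)^[j] x₀ = D.mate x then 1 else 0 := by
    rw [circleWalk, arc, ← List.range_map_iterate, List.map_map, List.map_map, ← hp,
      ← Finset.sum_add_distrib]
    refine (Finset.sum_apply (D.half x) (Finset.range p) _).trans ?_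
    refine Finset.sum_congr rfl fun j _ => ?_
    have hflip : D.mate ((D.step s)^[j] x₀) = x ↔ (D.step s)^[j] x₀ = D.mate x :=
      ⟨fun h => by rw [← h, mate_mate], fun h => by rw [h, mate_mate]⟩
    simp only [Function.comp_apply, ClosedSurface.edgeChain, ← D.half_mate,
      D.half_injective.eq_iff, hflip]
  have hone : ∀ y, (∃ n, (D.step s)^[n] x₀ = y) →
      (∑ j ∈ Finset.range p, if (D.step s)^[j] x₀ = y then (1 : ZMod 2) else 0) = 1 := by
    rintro y ⟨n, rfl⟩
    have hpos := D.minimalPeriod_step_pos s x₀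
    rw [Finset.sum_eq_single (n % p)]
    · rw [if_pos (Function.iterate_mod_minimalPeriod_eq)]
    · intro j hj hne
      rw [if_neg]
      intro h
      rw [← Function.iterate_mod_minimalPeriod_eq (n := n)] at h
      exact hne ((Function.iterate_eq_iterate_iff_of_lt_minimalPeriod (Finset.mem_range.mp hj)
        (Nat.mod_lt _ hpos)).mp h)
    · intro h
      exact absurd (Finset.mem_range.mpr (Nat.mod_lt _ hpos)) h
  have hzero : ∀ y, (¬ ∃ n, (D.step s)^[n] x₀ = y) →
      (∑ j ∈ Finset.range p, if (D.step s)^[j] x₀ = y then (1 : ZMod 2) else 0) = 0 := by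
    intro y hy
    exact Finset.sum_eq_zero fun j _ => if_neg fun h => hy ⟨j, h⟩
  have hexcl : ∀ y, (∃ n, (D.step s)^[n] x₀ = y) → ¬ ∃ n, (D.step s)^[n] x₀ = D.mate y := by
    rintro y ⟨n, hn⟩ ⟨m, hm⟩
    obtain ⟨l, hl⟩ := D.exists_iterate_symm s x₀ n
    apply D.step_iterate_ne_mate s (m + l) y
    rw [← hm, Function.iterate_add_apply, ← hn, hl]
  rw [hsum]
  split_ifs with h
  · rcases D.exists_iterate_of_circle_eq h.symm with h1 | h1
    · rw [hone x h1, hzero _ (hexcl x h1), add_zero]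
    · have h2 := hexcl _ h1
      rw [mate_mate] at h2
      rw [hone _ h1, hzero _ h2, zero_add]
  · rw [hzero, hzero, add_zero]
    · rintro ⟨n, hn⟩
      exact h (by rw [← circle_mate, ← hn, circle_iterate])
    · rintro ⟨n, hn⟩
      exact h (by rw [← hn, circle_iterate])

theorem sum_edgeChain_circleWalk_of_notMem (s : KauffmanState C) (x₀ : D.HalfEdge) (d : H)
    (hd : d ∉ Set.range D.half) : ((D.circleWalk s x₀).map F.edgeChain).sum d = 0 := by
  classical
  rw [circleWalk, arc, ← List.range_map_iterate, List.map_map, List.map_map]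
  refine (Finset.sum_apply d (Finset.range _) _).trans (Finset.sum_eq_zero fun j _ => ?_)
  simp only [Function.comp_apply, ClosedSurface.edgeChain, ← D.half_mate]
  rw [if_neg, if_neg, add_zero]
  · exact fun h => hd ⟨_, h⟩
  · exact fun h => hd ⟨_, h⟩

theorem next_iterate_crossing (i : C) (k : ZMod 4) (n : ℕ) :
    F.next^[n] (D.half (Sum.inl (i, k))) = D.half (Sum.inl (i, k + n)) := by
  induction n with
  | zero => simp
  | succ n ih => rw [Function.iterate_succ_apply', ih, D.next_crossing, Nat.cast_succ, add_assoc]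

/-- Between the two half-edges of the diagram at a regular point there are no others. -/
theorem exists_next_iterate_point [Finite H] (p : P) (k : ZMod 2) :
    ∃ n, F.next^[n + 1] (D.half (Sum.inr (p, k))) = D.half (Sum.inr (p, k + 1)) ∧
      ∀ j, 0 < j → j ≤ n → F.next^[j] (D.half (Sum.inr (p, k))) ∉ Set.range D.half := by
  classical
  have hsv : ∀ p k, F.SameVertex (D.half (Sum.inr (p, 0))) (D.half (Sum.inr (p, k))) := by
    intro p k
    have hk : k = 0 ∨ k = 1 := by revert k; decide
    rcases hk with rfl | rfl
    · exact Equiv.Perm.SameCycle.refl _ _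
    · exact D.sameVertex_point p
  have hex : ∃ n, F.next^[n + 1] (D.half (Sum.inr (p, k))) = D.half (Sum.inr (p, k + 1)) := by
    have h : F.next.SameCycle (D.half (Sum.inr (p, k))) (D.half (Sum.inr (p, k + 1))) :=
      (hsv p k).symm.trans (hsv p (k + 1))
    obtain ⟨n, hn, -, h⟩ := h.exists_pow_eq'' 
    refine ⟨n - 1, ?_⟩
    rw [Nat.sub_add_cancel hn, ← Equiv.Perm.coe_pow, h]
  refine ⟨Nat.find hex, Nat.find_spec hex, ?_⟩
  -- An intermediate half-edge `z` of `D` cannot sit at a crossing, so it is one of the two at `p`.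
  -- If it is the initial one, the remaining stretch is shorter than the minimum; if it is the final
  -- one, the target was reached earlier.
  rintro j hj hjn ⟨z, hz⟩
  have hrest : F.next^[Nat.find hex + 1 - j] (D.half z) = D.half (Sum.inr (p, k + 1)) := by
    rw [hz, ← Function.iterate_add_apply, Nat.sub_add_cancel (by omega), Nat.find_spec hex]
  rcases z with ⟨i, l⟩ | ⟨q, l⟩
  · rw [next_iterate_crossing] at hrest
    simpa using D.half_injective hrest
  · have hpq : q = p := by
      apply D.point_injective
      refine (hsv q l).trans (Equiv.Perm.SameCycle.trans ?_ (hsv p (k + 1)).symm)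
      rw [← hrest]
      exact ⟨(Nat.find hex + 1 - j : ℕ), by rw [zpow_natCast, Equiv.Perm.coe_pow]⟩
    subst hpq
    by_cases hl : l = k
    · subst hl
      exact Nat.find_min hex (m := Nat.find hex - j) (by omega)
        (by rw [← Nat.sub_add_comm hjn]; exact hrest)
    · have hl' : l = k + 1 := (by decide : ∀ k l : ZMod 2, ¬l = k → l = k + 1) k l hl
      subst hl'
      refine Nat.find_min hex (m := j - 1) (by omega) ?_
      rw [Nat.sub_add_cancel hj, ← hz]

/-- The set of faces bounded by the circle modulo 2, read off on the left of each edge. It remains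
to see that the left colour persists along every state circle, not only the given one. -/
theorem exists_isColoring [Finite H] [Finite C] [Finite P] (s : KauffmanState C) (x₀ : D.HalfEdge)
    (h : F.Contractible (D.circleWalk s x₀)) :
    ∃ f, D.IsColoring s (D.circle s x₀) f := by
  classical
  obtain ⟨g, hg, hgv⟩ := h.mem_boundaries
  have hself : ∀ a b c : ZMod 2, c = a + b → b = a + c := by decide
  have hnext : ∀ d, g (F.next.symm d) = g (F.opp d) := fun d => by
    rw [← F.faceNext_opp, hg]
  have hmate : ∀ x, g (D.half (D.mate x)) =
      g (D.half x) + if D.circle s x = D.circle s x₀ then 1 else 0 := by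
    intro x
    rw [← sum_edgeChain_circleWalk, D.half_mate]
    exact hself _ _ _ (hgv _)
  have hface : ∀ i k, g (D.half (D.mate (Sum.inl (i, k + 1)))) = g (D.half (Sum.inl (i, k))) := by
    intro i k
    rw [D.half_mate, ← hnext, ← D.next_crossing, Equiv.symm_apply_apply]
  refine ⟨fun x => g (D.half x), hmate, hface, ?_⟩
  suffices hs : ∀ y, g (D.half (D.turn s y)) = g (D.half (D.mate y)) by
    intro x
    show g (D.half (D.turn s (D.mate x))) = g (D.half x)
    rw [hs, mate_mate]
  rintro (⟨i, k⟩ | ⟨p, k⟩)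
  · have hrec : ∀ k, g (D.half (Sum.inl (i, k))) = g (D.half (Sum.inl (i, k + 1))) +
        if D.circle s (Sum.inl (i, k + 1)) = D.circle s x₀ then 1 else 0 := fun k => by
      rw [← hface, hmate]
    have hk : g (D.half (D.mate (Sum.inl (i, k)))) = g (D.half (Sum.inl (i, k - 1))) := by
      rw [← hface, sub_add_cancel]
    rw [hk]
    have hc := fun k => D.circle_turn s (Sum.inl (i, k))
    have r0 := hrec 0
    have r1 := hrec 1
    have r2 := hrec 2
    have r3 := hrec 3
    rw [show (3 + 1 : ZMod 4) = 0 from rfl] at r3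
    rw [show (2 + 1 : ZMod 4) = 3 from rfl] at r2
    rw [show (1 + 1 : ZMod 4) = 2 from rfl] at r1
    rw [zero_add] at r0
    have hcancel : ∀ a b c : ZMod 2, a + c = b + c → a = b := by decide
    have hk4 : k = 0 ∨ k = 1 ∨ k = 2 ∨ k = 3 :=
      (by decide : ∀ k : ZMod 4, k = 0 ∨ k = 1 ∨ k = 2 ∨ k = 3) k
    by_cases hsi : s i
    · simp only [turn, hsi, if_true] at hc ⊢
      have c0 : D.circle s (Sum.inl (i, 3)) = D.circle s (Sum.inl (i, 0)) := hc 0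
      have c1 : D.circle s (Sum.inl (i, 2)) = D.circle s (Sum.inl (i, 1)) := hc 1
      rw [c0] at r2
      rw [c1] at r1
      -- The two sectors joined by the `A` resolution have equal colours: between them lie the
      -- half-edges `1` and `2`, which belong to one circle and so change the colour twice or not at
      -- all.
      have h02 : g (D.half (Sum.inl (i, 0))) = g (D.half (Sum.inl (i, 2))) := by
        rw [r0, r1, add_assoc, CharTwo.add_self_eq_zero, add_zero]
      rcases hk4 with rfl | rfl | rfl | rfl
      · rfl
      · exact h02.symm
      · rfl
      · exact h02
    · simp only [turn, hsi, Bool.false_eq_true, if_false] at hc ⊢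
      have c0 : D.circle s (Sum.inl (i, 1)) = D.circle s (Sum.inl (i, 0)) := hc 0
      have c1 : D.circle s (Sum.inl (i, 3)) = D.circle s (Sum.inl (i, 2)) := hc 2
      rw [c0] at r0
      have h13 : g (D.half (Sum.inl (i, 1))) = g (D.half (Sum.inl (i, 3))) := by
        rw [r3, r0, add_assoc, CharTwo.add_self_eq_zero, add_zero]
      rcases hk4 with rfl | rfl | rfl | rfl
      · exact h13
      · rfl
      · exact h13.symm
      · rfl
  · obtain ⟨n, hn, hfree⟩ := D.exists_next_iterate_point p (k + 1)
    rw [(by decide : ∀ k : ZMod 2, k + 1 + 1 = k) k] at hn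
    -- The edges between the two half-edges of `D` at `p` are not in `D`, so crossing them leaves
    -- the colour unchanged.
    have hconst : ∀ j, j ≤ n → g (F.next^[j] (D.half (Sum.inr (p, k + 1)))) =
        g (D.half (Sum.inr (p, k + 1))) := by
      intro j
      induction j with
      | zero => intro; rfl
      | succ j ih =>
        intro hj
        rw [← ih (by omega)]
        have h0 := hgv (F.next^[j + 1] (D.half (Sum.inr (p, k + 1))))
        rw [D.sum_edgeChain_circleWalk_of_notMem s x₀ _ (hfree (j + 1) (by omega) hj), ← hnext,
          Function.iterate_succ_apply', Equiv.symm_apply_apply] at h0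
        have : ∀ a b : ZMod 2, 0 = a + b → a = b := by decide
        rw [Function.iterate_succ_apply']
        exact this _ _ h0
    show g (D.half (Sum.inr (p, k + 1))) = _
    rw [D.half_mate, ← hnext, ← hn, Function.iterate_succ_apply', Equiv.symm_apply_apply,
      hconst n le_rfl]

end LinkDiagram

namespace LinkDiagram

variable {H C P : Type*} {F : ClosedSurface H} (D : LinkDiagram F C P)

/-! ### Changing the resolution of one crossing -/

open Classical in
/-- The state that differs from `s` at the crossing `i` only. -/
def _root_.KauffmanState.flip (s : KauffmanState C) (i : C) : KauffmanState C :=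
  Function.update s i (!s i)

theorem _root_.KauffmanState.flip_flip (s : KauffmanState C) (i : C) : (s.flip i).flip i = s := by
  simp [KauffmanState.flip]

theorem turn_flip_inl (s : KauffmanState C) (i : C) (k : ZMod 4) :
    D.turn (s.flip i) (Sum.inl (i, k)) = D.turn s (Sum.inl (i, k + 2)) := by
  by_cases h : s i
  · simpa [turn, KauffmanState.flip, h] using (by decide : ∀ k : ZMod 4, 1 - k = 3 - (k + 2)) k
  · simpa [turn, KauffmanState.flip, h] using (by decide : ∀ k : ZMod 4, 3 - k = 1 - (k + 2)) k

theorem turn_flip_of_ne (s : KauffmanState C) {i : C} {x : D.HalfEdge}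
    (h : D.vertex x ≠ Sum.inl i) : D.turn (s.flip i) x = D.turn s x := by
  rcases x with ⟨j, k⟩ | ⟨p, k⟩
  · have : j ≠ i := fun hj => h (by rw [← hj]; rfl)
    simp [turn, KauffmanState.flip, this]
  · rfl

theorem crossing_cases (s : KauffmanState C) (i : C) (k l : ZMod 4) :
    (Sum.inl (i, k) : D.HalfEdge) = Sum.inl (i, l) ∨
    (Sum.inl (i, k) : D.HalfEdge) = D.turn s (Sum.inl (i, l)) ∨
    (Sum.inl (i, k) : D.HalfEdge) = Sum.inl (i, l + 2) ∨
    (Sum.inl (i, k) : D.HalfEdge) = D.turn s (Sum.inl (i, l + 2)) := by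
  by_cases h : s i
  · simpa [turn, h] using
      (by decide : ∀ k l : ZMod 4, k = l ∨ k = 3 - l ∨ k = l + 2 ∨ k = 3 - (l + 2)) k l
  · simpa [turn, h] using
      (by decide : ∀ k l : ZMod 4, k = l ∨ k = 1 - l ∨ k = l + 2 ∨ k = 1 - (l + 2)) k l

theorem circle_crossing_cases (s : KauffmanState C) (i : C) (k l : ZMod 4) :
    D.circle s (Sum.inl (i, k)) = D.circle s (Sum.inl (i, l)) ∨
    D.circle s (Sum.inl (i, k)) = D.circle s (Sum.inl (i, l + 2)) := by
  rcases D.crossing_cases s i k l with h | h | h | h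
  · exact Or.inl (by rw [h])
  · exact Or.inl (by rw [h, circle_turn])
  · exact Or.inr (by rw [h])
  · exact Or.inr (by rw [h, circle_turn])

/-- Both arcs at the resolved crossing `i` belong to the same state circle. -/
def IsLoop (s : KauffmanState C) (i : C) : Prop :=
  D.circle s (Sum.inl (i, 0)) = D.circle s (Sum.inl (i, 2))

theorem isDiag_ends (s : KauffmanState C) (i : C) : (D.ends s i).IsDiag ↔ D.IsLoop s i := by
  rw [ends, Sym2.mk_isDiag_iff, IsLoop]

variable {D}

theorem IsLoop.circle_eq {s : KauffmanState C} {i : C} (h : D.IsLoop s i) (k l : ZMod 4) :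
    D.circle s (Sum.inl (i, k)) = D.circle s (Sum.inl (i, l)) := by
  have h0 : ∀ k, D.circle s (Sum.inl (i, k)) = D.circle s (Sum.inl (i, 0)) := fun k => by
    rcases D.circle_crossing_cases s i k 0 with hk | hk
    · exact hk
    · rw [hk, zero_add]; exact h.symm
  rw [h0, h0 l]

theorem isLoop_of_circle_eq {s : KauffmanState C} {i : C} {k : ZMod 4}
    (h : D.circle s (Sum.inl (i, k)) = D.circle s (Sum.inl (i, k + 2))) : D.IsLoop s i := by
  have h0 : ∀ l, D.circle s (Sum.inl (i, l)) = D.circle s (Sum.inl (i, k)) := fun l => by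
    rcases D.circle_crossing_cases s i l k with hk | hk
    · exact hk
    · rw [hk, h]
  rw [IsLoop, h0, h0 2]

theorem eq_or_eq_turn_of_circle_eq {s : KauffmanState C} {i : C} (hi : ¬ D.IsLoop s i)
    {k l : ZMod 4} (h : D.circle s (Sum.inl (i, k)) = D.circle s (Sum.inl (i, l))) :
    (Sum.inl (i, k) : D.HalfEdge) = Sum.inl (i, l) ∨
    (Sum.inl (i, k) : D.HalfEdge) = D.turn s (Sum.inl (i, l)) := by
  rcases D.crossing_cases s i k l with hk | hk | hk | hk
  · exact Or.inl hk
  · exact Or.inr hk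
  · exact (hi (isLoop_of_circle_eq (k := l) (by rw [← hk, h]))).elim
  · refine (hi (isLoop_of_circle_eq (k := l) ?_)).elim
    rw [← D.circle_turn s (Sum.inl (i, l + 2)), ← hk, h]

theorem mk_circle_eq_ends (s : KauffmanState C) (i : C) (k : ZMod 4) :
    s(D.circle s (Sum.inl (i, k)), D.circle s (Sum.inl (i, k + 2))) = D.ends s i := by
  by_cases hi : D.IsLoop s i
  · rw [ends, hi.circle_eq k 0, hi.circle_eq (k + 2) 2]
  · rw [ends]
    have h1 := D.circle_crossing_cases s i k 0
    have h2 := D.circle_crossing_cases s i (k + 2) 0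
    rw [zero_add] at h1 h2
    have h3 : D.circle s (Sum.inl (i, k)) ≠ D.circle s (Sum.inl (i, k + 2)) := fun h =>
      hi (isLoop_of_circle_eq h)
    rcases h1 with h1 | h1 <;> rcases h2 with h2 | h2 <;> rw [h1, h2] at h3 ⊢
    · exact absurd rfl h3
    · exact Sym2.eq_swap
    · exact absurd rfl h3

/-- Reconnecting two different circles at a crossing merges them. -/
theorem isLoop_flip [Finite C] [Finite P] {s : KauffmanState C} {i : C} (hi : ¬ D.IsLoop s i) :
    D.IsLoop (s.flip i) i := by
  classical
  by_contra hf
  have := Fintype.ofFinite D.HalfEdge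
  set a : D.HalfEdge := Sum.inl (i, 0) with ha
  -- Parity argument: `U` is the intersection of the old and the new circle through `a`. If `i` were
  -- no loop after the change either, `a` would be the only half-edge of `U` at `i`. Then `mate`
  -- pairs off `U` while `turn s` pairs off `U` without `a`, so both sets have even size.
  set U : Finset D.HalfEdge := Finset.univ.filter fun x =>
    D.circle s x = D.circle s a ∧ D.circle (s.flip i) x = D.circle (s.flip i) a with hU
  have hmem : ∀ x, x ∈ U ↔ D.circle s x = D.circle s a ∧
    D.circle (s.flip i) x = D.circle (s.flip i) a := fun x => by simp [hU]
  have haU : a ∈ U := by simp [hU]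
  have hat : ∀ x ∈ U, D.vertex x = Sum.inl i → x = a := by
    intro x hx hv
    obtain ⟨k, rfl⟩ := D.vertex_eq_inl hv
    obtain ⟨h1, h2⟩ := (hmem _).mp hx
    rcases eq_or_eq_turn_of_circle_eq hi h1 with h | h
    · exact h
    rcases eq_or_eq_turn_of_circle_eq hf h2 with h' | h'
    · exact h'
    rw [h', turn_flip_inl] at h
    have := congrArg (D.turn s) h
    rw [turn_turn, turn_turn] at this
    simp at this
    exact absurd this (by decide)
  have hone : (1 : ZMod 2) + 1 = 0 := rfl
  have hU0 : ∑ x ∈ U, (1 : ZMod 2) = 0 := by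
    refine Finset.sum_involution (fun x _ => D.mate x) (fun _ _ => hone)
      (fun x _ _ => D.mate_ne x) (fun x hx => ?_) (fun x _ => D.mate_mate x)
    rw [hmem] at hx ⊢
    rwa [circle_mate, circle_mate]
  have hE0 : ∑ x ∈ U.erase a, (1 : ZMod 2) = 0 := by
    refine Finset.sum_involution (fun x _ => D.turn s x) (fun _ _ => hone)
      (fun x _ _ => D.turn_ne s x) (fun x hx => ?_) (fun x _ => D.turn_turn s x)
    rw [Finset.mem_erase] at hx ⊢
    have hv : D.vertex x ≠ Sum.inl i := fun h => hx.1 (hat x hx.2 h)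
    refine ⟨fun h => hv (by rw [← D.vertex_turn s, h]; rfl), ?_⟩
    have hx2 := hx.2
    rw [hmem] at hx2 ⊢
    exact ⟨by rw [circle_turn, hx2.1], by rw [← D.turn_flip_of_ne s hv, circle_turn, hx2.2]⟩
  rw [← Finset.add_sum_erase U _ haU, hE0] at hU0
  exact absurd hU0 (by decide)

theorem circle_flip_eq_of_circle_eq [Finite C] [Finite P] {s : KauffmanState C} {i : C}
    (hi : ¬ D.IsLoop s i) {x y : D.HalfEdge} (h : D.circle s x = D.circle s y) :
    D.circle (s.flip i) x = D.circle (s.flip i) y := by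
  refine D.eq_of_circle_eq (D.circle_mate _) (fun x => ?_) h
  by_cases hv : D.vertex x = Sum.inl i
  · obtain ⟨k, rfl⟩ := D.vertex_eq_inl hv
    obtain ⟨l, hl⟩ := D.vertex_eq_inl ((D.vertex_turn s (Sum.inl (i, k))).trans hv)
    rw [hl]
    exact (isLoop_flip hi).circle_eq _ _
  · rw [← D.turn_flip_of_ne s hv, circle_turn]

/-- The circles after merging the two circles at the crossing `i`. -/
theorem circle_flip_eq_iff [Finite C] [Finite P] {s : KauffmanState C} {i : C}
    (hi : ¬ D.IsLoop s i) {x y : D.HalfEdge} :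
    D.circle (s.flip i) x = D.circle (s.flip i) y ↔ D.circle s x = D.circle s y ∨
      (D.circle s x ∈ D.ends s i ∧ D.circle s y ∈ D.ends s i) := by
  classical
  constructor
  · intro h
    refine D.circle_induction (p := fun y => D.circle s x = D.circle s y ∨
      (D.circle s x ∈ D.ends s i ∧ D.circle s y ∈ D.ends s i)) (fun y hy => ?_) (fun y hy => ?_)
      h (Or.inl rfl)
    · rwa [circle_mate]
    · by_cases hv : D.vertex y = Sum.inl i
      · obtain ⟨k, rfl⟩ := D.vertex_eq_inl hv
        obtain ⟨l, hl⟩ := D.vertex_eq_inl ((D.vertex_turn (s.flip i) (Sum.inl (i, k))).trans hv)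
        rw [hl]
        have hmem : ∀ k, D.circle s (Sum.inl (i, k)) ∈ D.ends s i := fun k => by
          rw [← mk_circle_eq_ends s i k]
          exact Sym2.mem_mk_left _ _
        refine Or.inr ⟨?_, hmem l⟩
        rcases hy with hy | hy
        · rw [hy]; exact hmem k
        · exact hy.1
      · rwa [D.turn_flip_of_ne s hv, circle_turn]
  · rintro (h | ⟨h1, h2⟩)
    · exact circle_flip_eq_of_circle_eq hi h
    · have hall : ∀ x, D.circle s x ∈ D.ends s i →
          D.circle (s.flip i) x = D.circle (s.flip i) (Sum.inl (i, 0)) := by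
        intro x hx
        rw [ends, Sym2.mem_iff] at hx
        rcases hx with hx | hx
        · exact circle_flip_eq_of_circle_eq hi hx
        · exact (circle_flip_eq_of_circle_eq hi hx).trans ((isLoop_flip hi).circle_eq _ _)
      rw [hall x h1, hall y h2]

instance finite_circle [Finite C] [Finite P] (s : KauffmanState C) : Finite (D.Circle s) :=
  Finite.of_surjective _ (D.circle_surjective s)

/-- After one of the two merged circles is left out, the old circles correspond one to one to the
new ones. -/
theorem numCircles_flip_add_one [Finite C] [Finite P] {s : KauffmanState C} {i : C}
    (hi : ¬ D.IsLoop s i) : D.numCircles (s.flip i) + 1 = D.numCircles s := by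
  classical
  let c₁ := D.circle s (Sum.inl (i, 0))
  let c₂ := D.circle s (Sum.inl (i, 2))
  have hc : c₁ ≠ c₂ := hi
  let g : {c : D.Circle s // c ≠ c₂} → D.Circle (s.flip i) := fun c =>
    Quot.lift (fun x => D.circle (s.flip i) x) (by
      rintro x y (rfl | rfl)
      · rw [circle_mate]
      · exact circle_flip_eq_of_circle_eq hi (D.circle_turn s x).symm) c.1
  have hg : ∀ x (hx : D.circle s x ≠ c₂), g ⟨D.circle s x, hx⟩ = D.circle (s.flip i) x :=
    fun x hx => rfl
  have hbij : Function.Bijective g := by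
    constructor
    · rintro ⟨a, ha⟩ ⟨b, hb⟩ hab
      obtain ⟨x, rfl⟩ := D.circle_surjective s a
      obtain ⟨y, rfl⟩ := D.circle_surjective s b
      rw [hg, hg, circle_flip_eq_iff hi, ends, Sym2.mem_iff, Sym2.mem_iff] at hab
      refine Subtype.ext ?_
      rcases hab with hab | ⟨h1 | h1, h2 | h2⟩
      · exact hab
      · exact h1.trans h2.symm
      · exact (hb h2).elim
      · exact (ha h1).elim
      · exact (hb h2).elim
    · intro c
      obtain ⟨x, rfl⟩ := D.circle_surjective _ c
      by_cases hx : D.circle s x = c₂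
      · refine ⟨⟨c₁, hc⟩, ?_⟩
        refine (hg (Sum.inl (i, 0)) hc).trans ((circle_flip_eq_iff hi).mpr (Or.inr ?_))
        rw [hx, ends]
        exact ⟨Sym2.mem_mk_left _ _, Sym2.mem_mk_right _ _⟩
      · exact ⟨⟨_, hx⟩, rfl⟩
  rw [numCircles, numCircles, ← Nat.card_congr (Equiv.ofBijective g hbij), ← Finite.card_option]
  exact Nat.card_congr (Equiv.optionSubtypeNe c₂)

/-- On a surface of positive genus a circle can be reconnected to a single circle. The two states
then partition the half-edges in the same way. -/
theorem numCircles_eq_of_isLoop_flip [Finite C] [Finite P] {s : KauffmanState C} {i : C}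
    (hi : D.IsLoop s i) (hf : D.IsLoop (s.flip i) i) :
    D.numCircles (s.flip i) = D.numCircles s := by
  have key : ∀ s : KauffmanState C, D.IsLoop s i → ∀ x y,
      D.circle (s.flip i) x = D.circle (s.flip i) y → D.circle s x = D.circle s y := by
    intro s hi x y h
    refine D.eq_of_circle_eq (D.circle_mate s) (fun x => ?_) h
    by_cases hv : D.vertex x = Sum.inl i
    · obtain ⟨k, rfl⟩ := D.vertex_eq_inl hv
      obtain ⟨l, hl⟩ := D.vertex_eq_inl ((D.vertex_turn (s.flip i) (Sum.inl (i, k))).trans hv)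
      rw [hl]
      exact hi.circle_eq _ _
    · rw [D.turn_flip_of_ne s hv, circle_turn]
  have key' : ∀ x y, D.circle s x = D.circle s y →
      D.circle (s.flip i) x = D.circle (s.flip i) y := by
    intro x y h
    refine key (s.flip i) hf x y ?_
    rwa [KauffmanState.flip_flip]
  refine Nat.card_congr
    ⟨Quot.lift (D.circle s) ?_, Quot.lift (D.circle (s.flip i)) ?_, ?_, ?_⟩
  · exact fun x y h => key s hi x y (Quot.sound h)
  · exact fun x y h => key' x y (Quot.sound h)
  · exact fun c => Quot.inductionOn c fun x => rfl
  · exact fun c => Quot.inductionOn c fun x => rfl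

theorem numCircles_flip_le [Finite C] [Finite P] (s : KauffmanState C) (i : C) :
    D.numCircles (s.flip i) ≤ D.numCircles s + 1 := by
  by_cases hi : D.IsLoop s i
  · by_cases hf : D.IsLoop (s.flip i) i
    · rw [numCircles_eq_of_isLoop_flip hi hf]; omega
    · have := numCircles_flip_add_one hf
      rw [KauffmanState.flip_flip] at this
      omega
  · have := numCircles_flip_add_one hi
    omega

theorem not_isLoop_of_numCircles_flip_lt [Finite C] [Finite P] {s : KauffmanState C} {i : C}
    (h : D.numCircles (s.flip i) < D.numCircles s) : ¬ D.IsLoop s i := by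
  intro hi
  by_cases hf : D.IsLoop (s.flip i) i
  · rw [numCircles_eq_of_isLoop_flip hi hf] at h; omega
  · have := numCircles_flip_add_one hf
    rw [KauffmanState.flip_flip] at this
    omega

/-! ### Potentials and colourings under a change of resolution -/

/-- A potential takes one value only on the half-edges at the crossing `i`. -/
def IsConstAt (φ : D.HalfEdge → F.EdgePathGroup) (i : C) : Prop :=
  ∀ k l, φ (Sum.inl (i, k)) = φ (Sum.inl (i, l))

theorem IsPotential.flip {s : KauffmanState C} {φ : D.HalfEdge → F.EdgePathGroup}
    (h : D.IsPotential s φ) {i : C} (hi : IsConstAt φ i) : D.IsPotential (s.flip i) φ where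
  mate := h.mate
  turn x := by
    by_cases hv : D.vertex x = Sum.inl i
    · obtain ⟨k, rfl⟩ := D.vertex_eq_inl hv
      obtain ⟨l, hl⟩ := D.vertex_eq_inl ((D.vertex_turn (s.flip i) (Sum.inl (i, k))).trans hv)
      rw [hl]
      exact hi _ _
    · rw [D.turn_flip_of_ne s hv, h.turn]

theorem IsPotential.isConstAt {s : KauffmanState C} {φ : D.HalfEdge → F.EdgePathGroup}
    (h : D.IsPotential s φ) {i : C} {k : ZMod 4}
    (hi : φ (Sum.inl (i, k)) = φ (Sum.inl (i, k + 2))) : IsConstAt φ i := by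
  have h0 : ∀ l, φ (Sum.inl (i, l)) = φ (Sum.inl (i, k)) := fun l => by
    rcases D.crossing_cases s i l k with hl | hl | hl | hl
    · rw [hl]
    · rw [hl, h.turn]
    · rw [hl, hi]
    · rw [hl, h.turn, hi]
  intro l l'
  rw [h0, h0 l']

/-- A potential can be made constant at a crossing where two different circles meet. -/
theorem IsPotential.exists_isConstAt {s : KauffmanState C} {φ : D.HalfEdge → F.EdgePathGroup}
    (h : D.IsPotential s φ) {i : C} (hi : ¬ D.IsLoop s i) :
    ∃ φ', D.IsPotential s φ' ∧ IsConstAt φ' i := by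
  classical
  let g : D.Circle s → F.EdgePathGroup := fun c =>
    if c = D.circle s (Sum.inl (i, 2)) then
      φ (Sum.inl (i, 0)) * (φ (Sum.inl (i, 2)))⁻¹ else 1
  refine ⟨_, h.gauge g, (h.gauge g).isConstAt (k := 0) ?_⟩
  have hi' : D.circle s (Sum.inl (i, 0)) ≠ D.circle s (Sum.inl (i, 2)) := hi
  simp [g, hi']

/-- Translating the potential on one of the two circles makes it constant at `i`, and then it is
also a potential for the merged circle. -/
theorem AllContractible.flip [Finite C] [Finite P] {s : KauffmanState C} (h : D.AllContractible s)
    {i : C} (hi : ¬ D.IsLoop s i) : D.AllContractible (s.flip i) := by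
  obtain ⟨φ, hφ⟩ := h.exists_isPotential
  obtain ⟨φ', hφ', hc⟩ := hφ.exists_isConstAt hi
  exact (hφ'.flip hc).allContractible

theorem IsColoring.add_one {s : KauffmanState C} {c : D.Circle s} {f : D.HalfEdge → ZMod 2}
    (h : D.IsColoring s c f) {i : C} {k : ZMod 4} (hk : D.circle s (Sum.inl (i, k + 1)) = c) :
    f (Sum.inl (i, k + 1)) = f (Sum.inl (i, k)) + 1 := by
  have h0 := h.mate (Sum.inl (i, k + 1))
  rw [h.face, if_pos hk] at h0
  rw [h0, add_assoc]
  exact (_root_.add_zero _).symm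

theorem IsColoring.add_zero {s : KauffmanState C} {c : D.Circle s} {f : D.HalfEdge → ZMod 2}
    (h : D.IsColoring s c f) {i : C} {k : ZMod 4} (hk : D.circle s (Sum.inl (i, k + 1)) ≠ c) :
    f (Sum.inl (i, k + 1)) = f (Sum.inl (i, k)) := by
  have h0 := h.mate (Sum.inl (i, k + 1))
  rw [h.face, if_neg hk, _root_.add_zero] at h0
  exact h0.symm

/-- A circle that meets a crossing in both arcs is split by reconnecting there if it separates the
surface; one of the two parts is the path from `(i, 0)` to the half-edge that follows it after
the reconnection. -/
theorem exists_path_of_isLoop [Finite C] [Finite P] {s : KauffmanState C} {i : C}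
    (hi : D.IsLoop s i) {f : D.HalfEdge → ZMod 2}
    (hf : D.IsColoring s (D.circle s (Sum.inl (i, 0))) f) :
    ∃ n, D.step s ((D.step s)^[n] (Sum.inl (i, 0))) = Sum.inl (i, 2) ∧
      ∀ j, 0 < j → j ≤ n → D.vertex ((D.step s)^[j] (Sum.inl (i, 0))) ≠ Sum.inl i := by
  classical
  set a : D.HalfEdge := Sum.inl (i, 0) with ha
  have hex : ∃ n, D.vertex ((D.step s)^[n + 1] a) = Sum.inl i := by
    refine ⟨Function.minimalPeriod (D.step s) a - 1, ?_⟩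
    rw [Nat.sub_add_cancel (D.minimalPeriod_step_pos s a), Function.iterate_minimalPeriod]
    rfl
  have hmin : ∀ j, 0 < j → j ≤ Nat.find hex → D.vertex ((D.step s)^[j] a) ≠ Sum.inl i := by
    intro j hj hjn h
    exact Nat.find_min hex (m := j - 1) (by omega) (by rwa [Nat.sub_add_cancel hj])
  have hspec := Nat.find_spec hex
  set n := Nat.find hex
  refine ⟨n, ?_, hmin⟩
  have hfa : ∀ j, f ((D.step s)^[j] a) = f a := by
    intro j
    induction j with
    | zero => rfl
    | succ j ih => rw [Function.iterate_succ_apply', hf.step, ih]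
  have hfn := hfa (n + 1)
  rw [Function.iterate_succ_apply'] at hspec hfn
  obtain ⟨k, hk⟩ := D.vertex_eq_inl hspec
  rw [hk] at hfn ⊢
  have hstep : ∀ k, f (Sum.inl (i, k + 1)) = f (Sum.inl (i, k)) + 1 := fun k =>
    hf.add_one (hi.circle_eq _ _)
  have hne : ∀ z : ZMod 2, z + 1 ≠ z := by decide
  have h1 := hstep 0
  have h2 := hstep 1
  have h3 := hstep 2
  rw [zero_add] at h1
  rw [show (1 + 1 : ZMod 4) = 2 from rfl] at h2
  rw [show (2 + 1 : ZMod 4) = 3 from rfl] at h3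
  -- These are the candidates for the first return to `i`. The left colour is constant along the
  -- walk but alternates around `i`, which excludes `1` and `3`. A return to `0` would close the
  -- circle before it meets `2`, although `i` is a loop.
  rcases (by decide : ∀ k : ZMod 4, k = 0 ∨ k = 1 ∨ k = 2 ∨ k = 3) k with rfl | rfl | rfl | rfl
  · exfalso
    have hW : ∀ x, (∃ j ≤ n, x = (D.step s)^[j] a ∨ x = D.mate ((D.step s)^[j] a)) →
        ∃ j ≤ n, D.turn s x = (D.step s)^[j] a ∨ D.turn s x = D.mate ((D.step s)^[j] a) := by
      rintro x ⟨j, hj, rfl | rfl⟩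
      · cases j with
        | zero =>
          refine ⟨n, le_rfl, Or.inr ?_⟩
          rw [Function.iterate_zero_apply, ← turn_step D s, hk]
        | succ j =>
          refine ⟨j, by omega, Or.inr ?_⟩
          rw [Function.iterate_succ_apply', turn_step]
      · by_cases hjn : j = n
        · subst hjn
          exact ⟨0, by omega, Or.inl hk⟩
        · exact ⟨j + 1, by omega, Or.inl (by rw [Function.iterate_succ_apply']; rfl)⟩
    obtain ⟨j, hj, h⟩ := D.circle_induction
      (p := fun x => ∃ j ≤ n, x = (D.step s)^[j] a ∨ x = D.mate ((D.step s)^[j] a))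
      (by
        rintro x ⟨j, hj, rfl | rfl⟩
        · exact ⟨j, hj, Or.inr rfl⟩
        · exact ⟨j, hj, Or.inl (D.mate_mate _)⟩) hW hi ⟨0, by omega, Or.inl rfl⟩
    rcases h with h | h
    · by_cases hj0 : j = 0
      · subst hj0
        exact absurd (show (2 : ZMod 4) = 0 from (Prod.ext_iff.mp (Sum.inl.inj h)).2) (by decide)
      · exact hmin j (by omega) hj (by rw [← h]; rfl)
    · rw [← turn_step D s] at h
      by_cases hjn : j = n
      · subst hjn
        rw [hk] at h
        exact D.turn_inl_ne_add_two s i 0 (by rw [zero_add, h])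
      · refine hmin (j + 1) (by omega) (by omega) ?_
        rw [Function.iterate_succ_apply', ← D.vertex_turn s, ← h]
        rfl
  · exact absurd (h1.symm.trans hfn) (hne _)
  · rfl
  · rw [h3, h2, h1] at hfn
    exact absurd hfn ((by decide : ∀ z : ZMod 2, z + 1 + 1 + 1 ≠ z) _)

/-- The path of `exists_path_of_isLoop`, with both orientations of its edges, is closed under the
new turns and misses `(i, 2)`; so it is a full circle of the new state. -/
theorem not_isLoop_flip_of_isColoring [Finite C] [Finite P] {s : KauffmanState C} {i : C}
    (hi : D.IsLoop s i) {f : D.HalfEdge → ZMod 2}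
    (hf : D.IsColoring s (D.circle s (Sum.inl (i, 0))) f) : ¬ D.IsLoop (s.flip i) i := by
  obtain ⟨n, hn, hmin⟩ := exists_path_of_isLoop hi hf
  intro hloop
  set a : D.HalfEdge := Sum.inl (i, 0) with ha
  have hend : D.turn (s.flip i) a = D.mate ((D.step s)^[n] a) := by
    rw [← turn_step D s, hn, ha, turn_flip_inl, zero_add]
  obtain ⟨j, hj, h⟩ := D.circle_induction (s := s.flip i)
    (p := fun x => ∃ j ≤ n, x = (D.step s)^[j] a ∨ x = D.mate ((D.step s)^[j] a))
    (by
      rintro x ⟨j, hj, rfl | rfl⟩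
      · exact ⟨j, hj, Or.inr rfl⟩
      · exact ⟨j, hj, Or.inl (D.mate_mate _)⟩)
    (by
      rintro x ⟨j, hj, rfl | rfl⟩
      · by_cases hj0 : j = 0
        · subst hj0
          exact ⟨n, le_rfl, Or.inr hend⟩
        · rw [D.turn_flip_of_ne s (hmin j (by omega) hj)]
          refine ⟨j - 1, by omega, Or.inr ?_⟩
          obtain ⟨j, rfl⟩ := Nat.exists_eq_succ_of_ne_zero hj0
          rw [Function.iterate_succ_apply', turn_step]
          rfl
      · by_cases hjn : j = n
        · subst hjn
          exact ⟨0, by omega, Or.inl (by rw [← hend, turn_turn]; rfl)⟩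
        · refine ⟨j + 1, by omega, Or.inl ?_⟩
          have hv := hmin (j + 1) (by omega) (by omega)
          rw [Function.iterate_succ_apply', ← D.vertex_turn s, turn_step] at hv
          rw [D.turn_flip_of_ne s hv, Function.iterate_succ_apply']
          rfl) hloop ⟨0, by omega, Or.inl rfl⟩
  rcases h with h | h
  · by_cases hj0 : j = 0
    · subst hj0
      exact absurd (show (2 : ZMod 4) = 0 from (Prod.ext_iff.mp (Sum.inl.inj h)).2) (by decide)
    · exact hmin j (by omega) hj (by rw [← h]; rfl)
  · by_cases hjn : j = n
    · subst hjn
      rw [← hend] at h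
      exact D.turn_inl_ne_add_two (s.flip i) i 0 (by rw [zero_add]; exact h.symm)
    · refine hmin (j + 1) (by omega) (by omega) ?_
      rw [Function.iterate_succ_apply', ← D.vertex_turn s, turn_step, ← h]
      rfl

/-- The path that becomes a circle by itself avoids `i` in its interior, so invariance of `θ` away
from `i` suffices. This serves to compare potentials of the two states. -/
theorem eq_turn_flip_of_isLoop [Finite C] [Finite P] {s : KauffmanState C} {i : C}
    (hi : D.IsLoop s i) {f : D.HalfEdge → ZMod 2}
    (hf : D.IsColoring s (D.circle s (Sum.inl (i, 0))) f) {α : Type*} {θ : D.HalfEdge → α}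
    (hm : ∀ x, θ (D.mate x) = θ x)
    (ht : ∀ x, D.vertex x ≠ Sum.inl i → θ (D.turn s x) = θ x) :
    θ (D.turn (s.flip i) (Sum.inl (i, 0))) = θ (Sum.inl (i, 0)) := by
  obtain ⟨n, hn, hmin⟩ := exists_path_of_isLoop hi hf
  have hj : ∀ j, j ≤ n → θ ((D.step s)^[j] (Sum.inl (i, 0))) = θ (Sum.inl (i, 0)) := by
    intro j
    induction j with
    | zero => intro; rfl
    | succ j ih =>
      intro hj
      have hv := hmin (j + 1) (by omega) hj
      rw [Function.iterate_succ_apply', ← D.vertex_turn s, turn_step] at hv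
      rw [Function.iterate_succ_apply', step, ht _ hv, hm, ih (by omega)]
  rw [turn_flip_inl, zero_add, ← hn, turn_step, hm, hj n le_rfl]

end LinkDiagram

/-! ### Changing a set of resolutions of a constant state -/

/-- The state with the same resolution at every crossing. -/
abbrev KauffmanState.const (C : Type*) (b : Bool) : KauffmanState C := fun _ => b

open Classical in
/-- The state that differs from the constant state `b` exactly at the crossings in `T`. -/
def KauffmanState.off {C : Type*} (b : Bool) (T : Finset C) : KauffmanState C :=
  fun i => if i ∈ T then !b else b

namespace LinkDiagram

variable {H C P : Type*} {F : ClosedSurface H} {D : LinkDiagram F C P} {b : Bool}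

open KauffmanState

theorem off_empty (b : Bool) : off b (∅ : Finset C) = const C b := by
  funext i
  simp [off]

theorem off_insert [DecidableEq C] (b : Bool) {T : Finset C} {j : C} (hj : j ∉ T) :
    off b (insert j T) = (off b T).flip j := by
  classical
  funext i
  by_cases h : i = j
  · subst h
    simp [off, KauffmanState.flip, hj]
  · simp [off, KauffmanState.flip, h]

theorem off_singleton (b : Bool) (i : C) : off b {i} = (const C b).flip i := by
  classical
  rw [← off_empty, ← off_insert b (Finset.notMem_empty i), insert_empty_eq]

theorem turn_off_inl (D : LinkDiagram F C P) {T : Finset C} {i : C} (hi : i ∈ T) (k : ZMod 4) :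
    D.turn (off b T) (Sum.inl (i, k)) = D.turn (const C b) (Sum.inl (i, k + 2)) := by
  cases b
  · simpa [turn, off, hi] using (by decide : ∀ k : ZMod 4, 3 - k = 1 - (k + 2)) k
  · simpa [turn, off, hi] using (by decide : ∀ k : ZMod 4, 1 - k = 3 - (k + 2)) k

theorem turn_off_of_notMem (D : LinkDiagram F C P) {T : Finset C} {x : D.HalfEdge}
    (hx : ∀ i ∈ T, D.vertex x ≠ Sum.inl i) : D.turn (off b T) x = D.turn (const C b) x := by
  rcases x with ⟨j, k⟩ | ⟨p, k⟩
  · have : j ∉ T := fun hj => hx j hj rfl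
    simp [turn, off, this]
  · rfl

/-! ### The two sides of a circle of a constant state -/

variable (D b) in
/-- The arc that leaves the crossing `i` along `k` has its other end next to it in
counterclockwise order. -/
def IsLeftArc (i : C) (k : ZMod 4) : Prop :=
  D.turn (const C b) (Sum.inl (i, k)) = Sum.inl (i, k + 1)

theorem IsLeftArc.add_two {i : C} {k : ZMod 4} (h : D.IsLeftArc b i k) :
    D.IsLeftArc b i (k + 2) := by
  cases b
  · simp only [IsLeftArc, turn, Bool.false_eq_true, if_false, Sum.inl.injEq, Prod.mk.injEq,
      true_and] at h ⊢
    exact (by decide : ∀ k : ZMod 4, 1 - k = k + 1 → 1 - (k + 2) = k + 2 + 1) k h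
  · simp only [IsLeftArc, turn, if_true, Sum.inl.injEq, Prod.mk.injEq, true_and] at h ⊢
    exact (by decide : ∀ k : ZMod 4, 3 - k = k + 1 → 3 - (k + 2) = k + 2 + 1) k h

theorem exists_isLeftArc_of_not {i : C} {k : ZMod 4} (h : ¬ D.IsLeftArc b i k) :
    ∃ l, k = l + 1 ∧ D.IsLeftArc b i l ∧
      D.turn (const C b) (Sum.inl (i, k)) = Sum.inl (i, l) := by
  refine ⟨k - 1, by ring, ?_⟩
  cases b
  · simp only [IsLeftArc, turn, Bool.false_eq_true, if_false, Sum.inl.injEq, Prod.mk.injEq,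
      true_and] at h ⊢
    exact (by decide : ∀ k : ZMod 4, ¬ 1 - k = k + 1 →
      1 - (k - 1) = k - 1 + 1 ∧ 1 - k = k - 1) k h
  · simp only [IsLeftArc, turn, if_true, Sum.inl.injEq, Prod.mk.injEq, true_and] at h ⊢
    exact (by decide : ∀ k : ZMod 4, ¬ 3 - k = k + 1 →
      3 - (k - 1) = k - 1 + 1 ∧ 3 - k = k - 1) k h

theorem IsLeftArc.circle_add_one {i : C} {k : ZMod 4} (h : D.IsLeftArc b i k) :
    D.circle (const C b) (Sum.inl (i, k + 1)) = D.circle (const C b) (Sum.inl (i, k)) := by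
  rw [← show D.turn (const C b) (Sum.inl (i, k)) = Sum.inl (i, k + 1) from h, circle_turn]

theorem circle_add_two_of_ends {s : KauffmanState C} {i : C} {c₁ c₂ : D.Circle s}
    (hi : D.ends s i = s(c₁, c₂)) {k : ZMod 4} (hk : D.circle s (Sum.inl (i, k)) = c₁) :
    D.circle s (Sum.inl (i, k + 2)) = c₂ := by
  rw [← mk_circle_eq_ends s i k, hk] at hi
  exact Sym2.congr_right.mp hi

theorem exists_isLeftArc {i : C} {c₁ c₂ : D.Circle (const C b)}
    (hi : D.ends (const C b) i = s(c₁, c₂)) :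
    ∃ k, D.circle (const C b) (Sum.inl (i, k)) = c₁ ∧ D.IsLeftArc b i k := by
  have : ∃ k, D.circle (const C b) (Sum.inl (i, k)) = c₁ := by
    rw [ends, Sym2.eq_iff] at hi
    rcases hi with hi | hi
    · exact ⟨0, hi.1⟩
    · exact ⟨2, hi.2⟩
  obtain ⟨k, hk⟩ := this
  by_cases h : D.IsLeftArc b i k
  · exact ⟨k, hk, h⟩
  · obtain ⟨l, -, hl, ht⟩ := exists_isLeftArc_of_not h
    exact ⟨l, by rw [← ht, circle_turn, hk], hl⟩

theorem IsColoring.turn {s : KauffmanState C} {c : D.Circle s} {f : D.HalfEdge → ZMod 2}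
    (h : D.IsColoring s c f) (x : D.HalfEdge) : f (D.turn s x) = f (D.mate x) := by
  have := h.step (D.mate x)
  rwa [LinkDiagram.step, mate_mate] at this

theorem IsColoring.const_of_ne {s : KauffmanState C} {c : D.Circle s} {f : D.HalfEdge → ZMod 2}
    (h : D.IsColoring s c f) {x y : D.HalfEdge} (hx : D.circle s x ≠ c)
    (hxy : D.circle s x = D.circle s y) : f x = f y := by
  have hm : ∀ y, D.circle s y ≠ c → f (D.mate y) = f y := fun y hy => by
    rw [h.mate, if_neg hy, _root_.add_zero]
  refine (D.circle_induction (p := fun y => D.circle s y ≠ c ∧ f x = f y)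
    (fun y hy => ⟨?_, ?_⟩) (fun y hy => ⟨?_, ?_⟩) hxy ⟨hx, rfl⟩).2
  · rw [circle_mate]; exact hy.1
  · rw [hm y hy.1, hy.2]
  · rw [circle_turn]; exact hy.1
  · rw [h.turn, hm y hy.1, hy.2]

/-- All crossings that join `c₁` with `c₂` lie on the same side of `c₁`. -/
theorem isLeftArc_iff {c₁ c₂ : D.Circle (const C b)} (hc : c₁ ≠ c₂) {f : D.HalfEdge → ZMod 2}
    (hf : D.IsColoring (const C b) c₁ f) {κ : ZMod 2}
    (hκ : ∀ x, D.circle (const C b) x = c₂ → f x = κ) {i : C}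
    (hi : D.ends (const C b) i = s(c₁, c₂)) {k : ZMod 4}
    (hk : D.circle (const C b) (Sum.inl (i, k)) = c₁) :
    D.IsLeftArc b i k ↔ f (Sum.inl (i, k)) = κ + 1 := by
  -- From the sector enclosed by the arc of `c₁`, crossing `k + 1` changes the colour, while
  -- crossing `k + 2`, which lies on `c₂`, does not; beyond it the colour is `κ`.
  have key : ∀ k, D.circle (const C b) (Sum.inl (i, k)) = c₁ → D.IsLeftArc b i k →
      κ = f (Sum.inl (i, k)) + 1 := by
    intro k hk hl
    have h2 := circle_add_two_of_ends hi hk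
    have h12 : k + 2 = k + 1 + 1 := by ring
    rw [← hκ _ h2, h12, hf.add_zero, hf.add_one (by rw [hl.circle_add_one, hk])]
    rw [← h12, h2]
    exact hc.symm
  constructor
  · intro h
    rw [key k hk h]
    exact (by decide : ∀ z : ZMod 2, z = z + 1 + 1) _
  · intro h
    by_contra hn
    obtain ⟨l, rfl, hl, ht⟩ := exists_isLeftArc_of_not hn
    have hl1 : D.circle (const C b) (Sum.inl (i, l)) = c₁ := by rw [← ht, circle_turn, hk]
    rw [hf.add_one hk, key l hl1 hl] at h
    exact (by decide : ∀ z : ZMod 2, z + 1 ≠ z + 1 + 1) _ h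

/-- A colouring of a state that differs from the constant state only at crossings between `c₁` and
`c₂` does not change along the side of `c₁` away from these crossings. -/
theorem IsColoring.eq_of_isLeftArc [Finite H] [Finite C] [Finite P]
    (hD : D.AllContractible (const C b)) {c₁ c₂ : D.Circle (const C b)} (hc : c₁ ≠ c₂)
    {T : Finset C} (hT : ∀ e ∈ T, D.ends (const C b) e = s(c₁, c₂))
    {c : D.Circle (off b T)} {f : D.HalfEdge → ZMod 2} (hf : D.IsColoring (off b T) c f)
    {i j : C} (hi : D.ends (const C b) i = s(c₁, c₂)) (hj : D.ends (const C b) j = s(c₁, c₂))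
    {k l : ZMod 4} (hk : D.circle (const C b) (Sum.inl (i, k)) = c₁)
    (hl : D.circle (const C b) (Sum.inl (j, l)) = c₁) (hik : D.IsLeftArc b i k)
    (hjl : D.IsLeftArc b j l) : f (Sum.inl (i, k)) = f (Sum.inl (j, l)) := by
  have hg : ∃ g, D.IsColoring (const C b) c₁ g := by
    rw [← hk]
    exact D.exists_isColoring _ _ (hD _)
  obtain ⟨g, hg⟩ := hg
  obtain ⟨κ, hκ⟩ : ∃ κ, ∀ x, D.circle (const C b) x = c₂ → g x = κ := by
    obtain ⟨y, hy⟩ := D.circle_surjective _ c₂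
    refine ⟨g y, fun x hx => hg.const_of_ne ?_ (hx.trans hy.symm)⟩
    rw [hx]
    exact hc.symm
  have hgm : ∀ x, D.circle (const C b) x = c₁ → g (D.mate x) = g x + 1 := fun x hx => by
    rw [hg.mate, if_pos hx]
  have hgt : ∀ x, D.circle (const C b) x = c₁ → g (D.turn (const C b) x) = g x + 1 :=
    fun x hx => by rw [hg.turn, hgm x hx]
  have hmove : ∀ x, D.circle (const C b) x = c₁ → g x = κ + 1 →
      f (D.mate (D.turn (const C b) x)) = f x := by
    intro x hx hgx
    by_cases hv : ∃ e ∈ T, D.vertex x = Sum.inl e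
    · obtain ⟨e, he, hv⟩ := hv
      obtain ⟨k, rfl⟩ := D.vertex_eq_inl hv
      have := (isLeftArc_iff hc hg hκ (hT e he) hx).mpr hgx
      rw [show D.turn (const C b) (Sum.inl (e, k)) = Sum.inl (e, k + 1) from this, hf.face]
    · push Not at hv
      rw [← hf.turn, D.turn_off_of_notMem (fun i hi => ?_), turn_turn]
      rw [vertex_turn]
      exact hv i hi
  -- `h` is the colour under `f` of the side of the edge that faces away from `c₂`. All changed
  -- crossings lie on the other side of `c₁`, so `h` is constant along `c₁`.
  let h : D.HalfEdge → ZMod 2 := fun x => if g x = κ + 1 then f x else f (D.mate x)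
  have hne : ∀ z : ZMod 2, z + 1 ≠ z := by decide
  have hne' : ∀ z w : ZMod 2, z ≠ w + 1 → z = w := by decide
  have hh : h (Sum.inl (i, k)) = h (Sum.inl (j, l)) := by
    refine (D.circle_induction (p := fun y => D.circle (const C b) y = c₁ ∧
      h (Sum.inl (i, k)) = h y) (fun y hy => ⟨?_, hy.2.trans ?_⟩)
      (fun y hy => ⟨?_, hy.2.trans ?_⟩) (hk.trans hl.symm) ⟨hk, rfl⟩).2
    · rw [circle_mate, hy.1]
    · simp only [h, hgm y hy.1, mate_mate]
      by_cases hgy : g y = κ + 1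
      · rw [if_pos hgy, if_neg (by rw [hgy]; exact hne _)]
      · rw [if_neg hgy, if_pos (by rw [hne' _ _ hgy])]
    · rw [circle_turn, hy.1]
    · simp only [h, hgt y hy.1]
      by_cases hgy : g y = κ + 1
      · rw [if_pos hgy, if_neg (by rw [hgy]; exact hne _), hmove y hy.1 hgy]
      · have hgy' : g (D.turn (const C b) y) = κ + 1 := by rw [hgt y hy.1, hne' _ _ hgy]
        rw [if_neg hgy, if_pos (by rw [hne' _ _ hgy])]
        have := hmove _ ((D.circle_turn _ y).trans hy.1) hgy'
        rwa [turn_turn] at this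
  simp only [h] at hh
  rwa [if_pos ((isLeftArc_iff hc hg hκ hi hk).mp hik),
    if_pos ((isLeftArc_iff hc hg hκ hj hl).mp hjl)] at hh

/-- After changing the resolution of some crossings between `c₁` and `c₂`, the arcs at every other
crossing between `c₁` and `c₂` belong to the same circle, provided that the circles are
contractible. -/
theorem isLoop_off [Finite H] [Finite C] [Finite P] (hD : D.AllContractible (const C b))
    {c₁ c₂ : D.Circle (const C b)} (hc : c₁ ≠ c₂) {T : Finset C} (hne : T.Nonempty)
    (hT : ∀ e ∈ T, D.ends (const C b) e = s(c₁, c₂)) (hDT : D.AllContractible (off b T))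
    {j : C} (hj : D.ends (const C b) j = s(c₁, c₂)) (hjT : j ∉ T) : D.IsLoop (off b T) j := by
  by_contra hloop
  obtain ⟨e, he⟩ := hne
  obtain ⟨k, hk, hjk⟩ := exists_isLeftArc hj
  obtain ⟨l, hl, hel⟩ := exists_isLeftArc (hT e he)
  obtain ⟨f, hf⟩ := D.exists_isColoring (off b T) _ (hDT (Sum.inl (j, k)))
  have h1 := hf.eq_of_isLeftArc hD hc hT hj (hT e he) hk hl hjk hel
  have hsw : ∀ i, D.ends (const C b) i = s(c₁, c₂) → D.ends (const C b) i = s(c₂, c₁) :=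
    fun i hi => hi.trans Sym2.eq_swap
  have h2 := hf.eq_of_isLeftArc hD hc.symm (fun i hi => hsw i (hT i hi)) (hsw j hj)
    (hsw e (hT e he)) (circle_add_two_of_ends hj hk) (circle_add_two_of_ends (hT e he) hl)
    hjk.add_two hel.add_two
  have a12 : ∀ k : ZMod 4, k + 2 = k + 1 + 1 := by decide
  -- At `j` the way from the far side of `c₁` to that of `c₂` crosses two distinct circles, only one
  -- of them the coloured one. At the changed crossing `e` the same way crosses one circle twice. By
  -- `h1` and `h2` the end colours agree, a contradiction.
  have hfj : f (Sum.inl (j, k + 2)) = f (Sum.inl (j, k)) + 1 := by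
    have hcirc : D.circle (off b T) (Sum.inl (j, k + 1)) = D.circle (off b T) (Sum.inl (j, k)) := by
      have ht : D.turn (off b T) (Sum.inl (j, k)) = Sum.inl (j, k + 1) := by
        rw [D.turn_off_of_notMem]
        · exact hjk
        · rintro i hi hv
          exact hjT ((Sum.inl.inj hv : j = i) ▸ hi)
      rw [← ht, circle_turn]
    rw [a12, hf.add_zero, hf.add_one hcirc]
    rw [← a12]
    exact fun h => hloop (isLoop_of_circle_eq h.symm)
  have hfe : f (Sum.inl (e, l + 2)) = f (Sum.inl (e, l)) := by
    have hcirc : D.circle (off b T) (Sum.inl (e, l + 1 + 1)) =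
        D.circle (off b T) (Sum.inl (e, l + 1)) := by
      have ht : D.turn (off b T) (Sum.inl (e, l + 1)) = Sum.inl (e, l + 1 + 1) := by
        rw [turn_off_inl D he, show l + 1 + 2 = l + 2 + 1 by ring,
          ← show D.turn (const C b) (Sum.inl (e, l + 2)) = Sum.inl (e, l + 2 + 1) from hel.add_two,
          turn_turn, a12]
      rw [← ht, circle_turn]
    rw [a12]
    by_cases hcl : D.circle (off b T) (Sum.inl (e, l + 1)) =
        D.circle (off b T) (Sum.inl (j, k))
    · rw [hf.add_one (hcirc.trans hcl), hf.add_one hcl]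
      exact (by decide : ∀ z : ZMod 2, z + 1 + 1 = z) _
    · rw [hf.add_zero (by rw [hcirc]; exact hcl), hf.add_zero hcl]
  rw [hfj, hfe, h1] at h2
  exact (by decide : ∀ z : ZMod 2, z + 1 ≠ z) _ h2

/-! ### Parallel edges -/

theorem ends_eq_of_circle_ne {s : KauffmanState C} {i : C} {k l : ZMod 4}
    (h : D.circle s (Sum.inl (i, k)) ≠ D.circle s (Sum.inl (i, l))) :
    D.ends s i = s(D.circle s (Sum.inl (i, k)), D.circle s (Sum.inl (i, l))) := by
  rw [← mk_circle_eq_ends s i k]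
  rcases D.circle_crossing_cases s i l k with hl | hl
  · exact absurd hl.symm h
  · rw [hl]

theorem IsPotential.isConstAt_of_circle_ne {s : KauffmanState C}
    {φ : D.HalfEdge → F.EdgePathGroup} (h : D.IsPotential s φ) {i : C} {k l : ZMod 4}
    (hc : D.circle s (Sum.inl (i, k)) ≠ D.circle s (Sum.inl (i, l)))
    (hi : φ (Sum.inl (i, k)) = φ (Sum.inl (i, l))) : IsConstAt φ i := by
  apply h.isConstAt (k := k)
  rcases D.crossing_cases s i l k with hl | hl | hl | hl
  · exact absurd (by rw [hl]) hc
  · exact absurd (by rw [hl, circle_turn]) hc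
  · rw [hi, hl]
  · rw [hi, hl, h.turn]

/-- The increments of `φ` along the two arcs are their classes. Since `φ` does not jump at `i`, the
product of the classes is trivial exactly when `φ` does not jump at `j`. -/
theorem parallel_iff [Finite C] [Finite P] {s : KauffmanState C}
    {φ : D.HalfEdge → F.EdgePathGroup} (hφ : D.IsPotential s φ) {i j : C} (hi : ¬ D.IsLoop s i)
    (hc : IsConstAt φ i) :
    D.Parallel s i j ↔ D.ends s i = D.ends s j ∧ IsConstAt φ j := by
  constructor
  · rintro ⟨k, l, k', l', m, n, hm, hn, hne, hcon⟩
    have h1 := hφ.iterate (Sum.inl (i, k)) m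
    have h2 := hφ.iterate (Sum.inl (j, l')) n
    have c1 := D.circle_iterate s m (Sum.inl (i, k))
    have c2 := D.circle_iterate s n (Sum.inl (j, l'))
    have h3 : D.arcClass s (Sum.inl (i, k)) m * D.arcClass s (Sum.inl (j, l')) n = 1 := by
      rw [arcClass, arcClass, ← List.prod_append, ← List.map_append]
      exact hcon
    rw [hm] at h1 c1
    rw [hn] at h2 c2
    have hni : D.circle s (Sum.inl (i, k)) ≠ D.circle s (Sum.inl (i, k')) := by rwa [c2]
    have hnj : D.circle s (Sum.inl (j, l)) ≠ D.circle s (Sum.inl (j, l')) := by rwa [c1]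
    refine ⟨by rw [ends_eq_of_circle_ne hni, ends_eq_of_circle_ne hnj, c1, c2],
      hφ.isConstAt_of_circle_ne hnj ?_⟩
    rw [h1, hc k k', h2, mul_assoc, mul_eq_one_iff_eq_inv.mp h3, mul_inv_cancel, mul_one]
  · rintro ⟨hends, hcj⟩
    have hl : ∃ l, D.circle s (Sum.inl (j, l)) = D.circle s (Sum.inl (i, 0)) := by
      rw [ends, ends, Sym2.eq_iff] at hends
      rcases hends with h | h
      · exact ⟨0, h.1.symm⟩
      · exact ⟨2, h.1.symm⟩
    obtain ⟨l, hl⟩ := hl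
    have hl2 : D.circle s (Sum.inl (j, l + 2)) = D.circle s (Sum.inl (i, 2)) :=
      circle_add_two_of_ends (hends.symm.trans rfl) hl
    obtain ⟨m, hm⟩ : ∃ m l₁, (D.step s)^[m] (Sum.inl (i, 0)) = Sum.inl (j, l₁) := by
      obtain ⟨m, hm | hm⟩ := D.exists_iterate_or_turn hl.symm
      · exact ⟨m, l, hm⟩
      · exact ⟨m, _, hm⟩
    obtain ⟨n, hn⟩ : ∃ n k', (D.step s)^[n] (Sum.inl (j, l + 2)) = Sum.inl (i, k') := by
      obtain ⟨n, hn | hn⟩ := D.exists_iterate_or_turn hl2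
      · exact ⟨n, 2, hn⟩
      · exact ⟨n, _, hn⟩
    obtain ⟨l₁, hm⟩ := hm
    obtain ⟨k', hn⟩ := hn
    refine ⟨0, l₁, k', l + 2, m, n, hm, hn, by rw [hl2]; exact hi, ?_⟩
    have h1 := hφ.iterate (Sum.inl (i, 0)) m
    have h2 := hφ.iterate (Sum.inl (j, l + 2)) n
    rw [hm] at h1
    rw [hn, hcj _ l₁, h1, hc _ 0, mul_assoc, left_eq_mul] at h2
    rw [ClosedSurface.Contractible, List.map_append, List.prod_append]
    exact h2

theorem GeometricallyAdequate.not_isLoop {s : KauffmanState C} (h : D.GeometricallyAdequate s)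
    (i : C) : ¬ D.IsLoop s i := by
  rw [← isDiag_ends]
  exact h.2 i

theorem GeometricallyAdequate.exists_isConstAt [Finite C] [Finite P] {s : KauffmanState C}
    (h : D.GeometricallyAdequate s) (i : C) : ∃ φ, D.IsPotential s φ ∧ IsConstAt φ i := by
  obtain ⟨φ, hφ⟩ := h.1.exists_isPotential
  exact hφ.exists_isConstAt (h.not_isLoop i)

theorem GeometricallyAdequate.equivalence_parallel [Finite C] [Finite P] {s : KauffmanState C}
    (h : D.GeometricallyAdequate s) : Equivalence (D.Parallel s) where
  refl i := by
    obtain ⟨φ, hφ, hi⟩ := h.exists_isConstAt i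
    exact (parallel_iff hφ (h.not_isLoop i) hi).mpr ⟨rfl, hi⟩
  symm := by
    intro i j hij
    obtain ⟨φ, hφ, hi⟩ := h.exists_isConstAt i
    obtain ⟨he, hj⟩ := (parallel_iff hφ (h.not_isLoop i) hi).mp hij
    exact (parallel_iff hφ (h.not_isLoop j) hj).mpr ⟨he.symm, hi⟩
  trans := by
    intro i j k hij hjk
    obtain ⟨φ, hφ, hi⟩ := h.exists_isConstAt i
    obtain ⟨he, hj⟩ := (parallel_iff hφ (h.not_isLoop i) hi).mp hij
    obtain ⟨he', hk⟩ := (parallel_iff hφ (h.not_isLoop j) hj).mp hjk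
    exact (parallel_iff hφ (h.not_isLoop i) hi).mpr ⟨he.trans he', hk⟩

/-! ### The states with as many circles as possible -/

/-- By adequacy the first change loses a circle; each later change gains at most one. The difference
to gaining one every time is the `2`. -/
theorem numCircles_off_le [Finite C] [Finite P] (h : D.GeometricallyAdequate (const C b))
    {S : Finset C} (hS : S.Nonempty) :
    D.numCircles (off b S) + 2 ≤ D.numCircles (const C b) + S.card := by
  classical
  induction hS using Finset.Nonempty.cons_induction with
  | singleton i =>
    have := numCircles_flip_add_one (h.not_isLoop i)
    rw [off_singleton, Finset.card_singleton]
    omega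
  | cons i S hi hS ih =>
    rw [Finset.cons_eq_insert, off_insert b hi, Finset.card_insert_of_notMem hi]
    have := numCircles_flip_le (D := D) (off b S) i
    omega

/-- All circles are contractible, and their number is the largest possible for the given number of
changed resolutions. -/
def IsExtremal (D : LinkDiagram F C P) (b : Bool) (S : Finset C) : Prop :=
  D.AllContractible (off b S) ∧ D.numCircles (off b S) + 2 = D.numCircles (const C b) + S.card

/-- Equality forces the last change to gain a circle. Undoing it is a merge, and merging preserves
contractibility. -/
theorem isExtremal_of_insert [Finite C] [Finite P] [DecidableEq C]
    (h : D.GeometricallyAdequate (const C b)) {S : Finset C} (hS : S.Nonempty) {i : C} (hi : i ∉ S)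
    (hx : D.IsExtremal b (insert i S)) : D.IsExtremal b S := by
  obtain ⟨h1, h2⟩ := hx
  rw [off_insert b hi] at h1 h2
  rw [Finset.card_insert_of_notMem hi] at h2
  have h3 := numCircles_off_le h hS
  have h4 := numCircles_flip_le (D := D) (off b S) i
  refine ⟨?_, by omega⟩
  rw [← KauffmanState.flip_flip (off b S) i]
  refine h1.flip (not_isLoop_of_numCircles_flip_lt ?_)
  rw [KauffmanState.flip_flip]
  omega

theorem IsExtremal.subset [Finite C] [Finite P] (h : D.GeometricallyAdequate (const C b))
    {S T : Finset C} (hS : D.IsExtremal b S) (hTS : T ⊆ S) (hT : T.Nonempty) :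
    D.IsExtremal b T := by
  classical
  obtain ⟨U, hU, rfl⟩ : ∃ U, Disjoint U T ∧ S = U ∪ T :=
    ⟨S \ T, Finset.sdiff_disjoint, (Finset.sdiff_union_of_subset hTS).symm⟩
  clear hTS
  induction U using Finset.induction_on with
  | empty => rwa [Finset.empty_union] at hS
  | insert a U ha ih =>
    rw [Finset.disjoint_insert_left] at hU
    rw [Finset.insert_union] at hS
    refine ih hU.2 (isExtremal_of_insert h (hT.mono Finset.subset_union_right) ?_ hS)
    rw [Finset.mem_union]
    exact fun h => h.elim ha hU.1

/-- By heredity only `{i, j}` matters. The second change must not merge, so `j` has both arcs on the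
circle merged at `i` and joins the same two circles. -/
theorem IsExtremal.parallel [Finite H] [Finite C] [Finite P]
    (h : D.GeometricallyAdequate (const C b)) {S : Finset C} (hS : D.IsExtremal b S) {i j : C}
    (hi : i ∈ S) (hj : j ∈ S) : D.Parallel (const C b) i j := by
  classical
  by_cases hij : i = j
  · rw [hij]; exact h.equivalence_parallel.refl j
  have hji : j ∉ ({i} : Finset C) := by simpa using Ne.symm hij
  obtain ⟨h1, h2⟩ : D.IsExtremal b (insert j {i}) :=
    hS.subset h (Finset.insert_subset hj (Finset.singleton_subset_iff.mpr hi))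
      (Finset.insert_nonempty _ _)
  rw [off_insert b hji, off_singleton] at h1 h2
  rw [Finset.card_insert_of_notMem hji, Finset.card_singleton] at h2
  have hNi := numCircles_flip_add_one (h.not_isLoop i)
  have hloop : D.IsLoop ((const C b).flip i) j := by
    by_contra hl
    have := numCircles_flip_add_one hl
    omega
  obtain ⟨φ, hφ, hci⟩ := h.exists_isConstAt i
  have hφi := hφ.flip hci
  rw [parallel_iff hφ (h.not_isLoop i) hci]
  constructor
  · rcases (circle_flip_eq_iff (h.not_isLoop i)).mp hloop with he | he
    · exact absurd he (h.not_isLoop j)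
    · exact (Sym2.mem_and_mem_iff (h.not_isLoop j)).mp he
  -- The quotient of the potentials after two changes and after one is constant along the split-off
  -- circle. As `ψ` does not jump across the new connection at `j`, neither does `φ`.
  · obtain ⟨ψ, hψ⟩ := h1.exists_isPotential
    obtain ⟨f, hf⟩ := D.exists_isColoring _ _ (hφi.allContractible (Sum.inl (j, 0)))
    have := eq_turn_flip_of_isLoop hloop hf (θ := fun x => ψ x * (φ x)⁻¹)
      (fun x => by simp only [hψ.mate, hφ.mate, mul_inv_rev, mul_assoc, mul_inv_cancel_left])
      (fun x hx => by rw [hφi.turn, ← D.turn_flip_of_ne _ hx, hψ.turn])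
    simp only [hψ.turn, mul_right_inj, inv_inj] at this
    rw [turn_flip_inl, hφi.turn] at this
    exact hφ.isConstAt this.symm

/-- One potential, constant at all crossings of `S`, serves every intermediate state. After the
first merge each further crossing is a loop on a contractible circle, so its change splits that
circle. -/
theorem isExtremal_of_parallel [Finite H] [Finite C] [Finite P]
    (h : D.GeometricallyAdequate (const C b)) {S : Finset C} (hS : S.Nonempty)
    (hpar : ∀ i ∈ S, ∀ j ∈ S, D.Parallel (const C b) i j) : D.IsExtremal b S := by
  classical
  obtain ⟨e, he⟩ := hS
  obtain ⟨φ, hφ, hce⟩ := h.exists_isConstAt e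
  have hj : ∀ j ∈ S, D.ends (const C b) e = D.ends (const C b) j ∧ IsConstAt φ j := fun j hj =>
    (parallel_iff hφ (h.not_isLoop e) hce).mp (hpar e he j hj)
  have hcontr : ∀ T ⊆ S, D.IsPotential (off b T) φ := by
    intro T
    induction T using Finset.induction_on with
    | empty => intro; rwa [off_empty]
    | insert a T ha ih =>
      intro hT
      rw [Finset.insert_subset_iff] at hT
      rw [off_insert b ha]
      exact (ih hT.2).flip (hj a hT.1).2
  suffices ∀ T : Finset C, T.Nonempty → T ⊆ S →
      D.numCircles (off b T) + 2 = D.numCircles (const C b) + T.card from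
    ⟨(hcontr S subset_rfl).allContractible, this S ⟨e, he⟩ subset_rfl⟩
  intro T hT
  induction hT using Finset.Nonempty.cons_induction with
  | singleton i =>
    intro
    have := numCircles_flip_add_one (h.not_isLoop i)
    rw [off_singleton, Finset.card_singleton]
    omega
  | cons i T hi hT ih =>
    intro hTS
    rw [Finset.cons_subset] at hTS
    have hT0 := (hcontr T hTS.2).allContractible
    have hloop : D.IsLoop (off b T) i :=
      isLoop_off h.1 (h.not_isLoop e) hT (fun a ha => (hj a (hTS.2 ha)).1.symm) hT0
        (hj i hTS.1).1.symm hi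
    obtain ⟨f, hf⟩ := D.exists_isColoring _ _ (hT0 (Sum.inl (i, 0)))
    have h1 := numCircles_flip_add_one (not_isLoop_flip_of_isColoring hloop hf)
    rw [KauffmanState.flip_flip] at h1
    have h2 := ih hTS.2
    rw [Finset.cons_eq_insert, off_insert b hi, Finset.card_insert_of_notMem hi]
    omega

end LinkDiagram

/-! ### Leading coefficients of powers of the circle factor -/

namespace LaurentPolynomial

theorem coeff_T_mul (a r : ℤ) (f : ℤ[T;T⁻¹]) : (T a * f).coeff r = f.coeff (r - a) := by
  rw [T, AddMonoidAlgebra.coeff_single_mul_eq_mul_coeff (r - a) (fun m _ => by omega), one_mul]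

theorem coeff_C_mul (u r : ℤ) (f : ℤ[T;T⁻¹]) : (C u * f).coeff r = u * f.coeff r := by
  rw [← smul_eq_C_mul, AddMonoidAlgebra.coeff_smul_apply, smul_eq_mul]

/-- The expansion begins with `(-1)^n (A^(2n) + n A^(2n-4) + ...)`. -/
theorem coeff_circleFactor_pow (n : ℕ) (r : ℤ) (hr : 2 * (n : ℤ) - 4 ≤ r) (hr' : r ≠ 2 * n - 3)
    (hr'' : r ≠ 2 * n - 2) (hr3 : r ≠ 2 * n - 1) :
    ((-T 2 - T (-2) : ℤ[T;T⁻¹]) ^ n).coeff r =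
      if r = 2 * n then (-1 : ℤ) ^ n else if r = 2 * n - 4 then (-1 : ℤ) ^ n * n else 0 := by
  induction n generalizing r with
  | zero =>
    rw [pow_zero, ← T_zero, T_apply]
    simp only [Nat.cast_zero, mul_zero, pow_zero, ite_self]
    exact if_congr eq_comm rfl rfl
  | succ n ih =>
    have hrec : ((-T 2 - T (-2) : ℤ[T;T⁻¹]) ^ (n + 1)).coeff r =
        -((-T 2 - T (-2) : ℤ[T;T⁻¹]) ^ n).coeff (r - 2) -
          ((-T 2 - T (-2) : ℤ[T;T⁻¹]) ^ n).coeff (r + 2) := by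
      rw [pow_succ', sub_mul, neg_mul, AddMonoidAlgebra.coeff_sub, AddMonoidAlgebra.coeff_neg,
        Finsupp.sub_apply, Finsupp.neg_apply, coeff_T_mul, coeff_T_mul, sub_neg_eq_add]
    push_cast at hr hr' hr'' hr3 ⊢
    rw [hrec, ih (r - 2) (by omega) (by omega) (by omega) (by omega),
      ih (r + 2) (by omega) (by omega) (by omega) (by omega)]
    by_cases h1 : r = 2 * (n + 1)
    · rw [if_pos (by omega), if_neg (by omega), if_neg (by omega), if_pos h1, pow_succ]
      ring
    · by_cases h2 : r = 2 * (n + 1) - 4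
      · rw [if_neg (by omega), if_pos (by omega), if_pos (by omega), if_neg h1, if_pos h2, pow_succ]
        ring
      · rw [if_neg (by omega), if_neg (by omega), if_neg (by omega), if_neg (by omega),
          if_neg h1, if_neg h2]
        simp

theorem coeff_circleFactor_pow_of_lt {n : ℕ} {r : ℤ} (hr : 2 * (n : ℤ) < r) :
    ((-T 2 - T (-2) : ℤ[T;T⁻¹]) ^ n).coeff r = 0 := by
  rw [coeff_circleFactor_pow n r (by omega) (by omega) (by omega) (by omega), if_neg (by omega),
    if_neg (by omega)]

theorem coeff_circleFactor_pow_top (n : ℕ) :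
    ((-T 2 - T (-2) : ℤ[T;T⁻¹]) ^ n).coeff (2 * n) = (-1) ^ n := by
  rw [coeff_circleFactor_pow n _ (by omega) (by omega) (by omega) (by omega), if_pos rfl]

theorem coeff_circleFactor_pow_next (n : ℕ) :
    ((-T 2 - T (-2) : ℤ[T;T⁻¹]) ^ n).coeff (2 * n - 4) = (-1) ^ n * n := by
  rw [coeff_circleFactor_pow n _ (by omega) (by omega) (by omega) (by omega), if_neg (by omega),
    if_pos rfl]

end LaurentPolynomial

open Classical in
/-- The signed count of the non-empty sets that lie within a class of an equivalence relation. -/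
theorem Equivalence.sum_neg_one_pow_card {α : Type*} [Fintype α] {r : α → α → Prop}
    (hr : Equivalence r) :
    ∑ S : Finset α, (if S.Nonempty ∧ ∀ i ∈ S, ∀ j ∈ S, r i j then (-1 : ℤ) ^ S.card else 0) =
      -(Nat.card (Quot r) : ℤ) := by
  have := Fintype.ofFinite (Quot r)
  let cl : Quot r → Finset α := fun q => Finset.univ.filter fun i => Quot.mk r i = q
  have hcl : ∀ i q, i ∈ cl q ↔ Quot.mk r i = q := fun i q => by simp [cl]
  have hmk : ∀ i j, Quot.mk r i = Quot.mk r j ↔ r i j := fun i j =>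
    ⟨fun h => (hr.eqvGen_iff).mp (Quot.eqvGen_exact h), fun h => Quot.sound h⟩
  rw [← Finset.sum_filter]
  have hunion : (Finset.univ.filter fun S : Finset α => S.Nonempty ∧ ∀ i ∈ S, ∀ j ∈ S, r i j) =
      Finset.univ.biUnion fun q => (cl q).powerset.erase ∅ := by
    ext S
    simp only [Finset.mem_filter, Finset.mem_univ, true_and, Finset.mem_biUnion, Finset.mem_erase,
      Finset.mem_powerset, Finset.nonempty_iff_ne_empty]
    constructor
    · rintro ⟨hS, h⟩
      obtain ⟨e, he⟩ := Finset.nonempty_iff_ne_empty.mpr hS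
      exact ⟨Quot.mk r e, hS, fun i hi => (hcl _ _).mpr ((hmk i e).mpr (h i hi e he))⟩
    · rintro ⟨q, hS, h⟩
      exact ⟨hS, fun i hi j hj => (hmk i j).mp
        (((hcl _ _).mp (h hi)).trans ((hcl _ _).mp (h hj)).symm)⟩
  rw [hunion, Finset.sum_biUnion]
  -- The alternating sum over all subsets of a non-empty class is `0`, and the empty set accounts
  -- for `1`.
  · have hq : ∀ q, ∑ S ∈ (cl q).powerset.erase ∅, (-1 : ℤ) ^ S.card = -1 := by
      intro q
      have hne : (cl q).Nonempty := by
        obtain ⟨i, rfl⟩ := Quot.exists_rep q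
        exact ⟨i, (hcl _ _).mpr rfl⟩
      have h0 := Finset.sum_powerset_neg_one_pow_card_of_nonempty hne
      rw [← Finset.add_sum_erase _ _ (Finset.empty_mem_powerset (cl q)), Finset.card_empty,
        pow_zero] at h0
      linarith
    rw [Finset.sum_congr rfl fun q _ => hq q, Finset.sum_const, Finset.card_univ,
      Nat.card_eq_fintype_card]
    simp
  · intro q _ q' _ hqq'
    rw [Function.onFun, Finset.disjoint_left]
    intro S hS hS'
    rw [Finset.mem_erase, Finset.mem_powerset] at hS hS'
    obtain ⟨e, he⟩ := Finset.nonempty_iff_ne_empty.mpr hS.1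
    exact hqq' (((hcl _ _).mp (hS.2 he)).symm.trans ((hcl _ _).mp (hS'.2 he)))

namespace LinkDiagram

variable {H C P : Type*} {F : ClosedSurface H} {D : LinkDiagram F C P} {b : Bool}

open KauffmanState

/-! ### The extreme coefficients of the bracket -/

/-- Makes the exponent `|s| - 1` in `ℕ` an untruncated subtraction. -/
theorem numCircles_pos [Finite C] [Finite P] (hD : Nonempty D.HalfEdge) (s : KauffmanState C) :
    0 < D.numCircles s :=
  have : Nonempty (D.Circle s) := hD.map (D.circle s)
  Nat.card_pos

open Classical in
variable (D b) in
/-- The Kauffman bracket in the variable `A` for `b = true` and `A⁻¹` for `b = false`. -/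
def bracketAt [Fintype C] : ℤ[T;T⁻¹] :=
  ∑ s : KauffmanState C, if D.AllContractible s then
    LaurentPolynomial.T (∑ i, if s i = b then (1 : ℤ) else -1) *
      (-LaurentPolynomial.T 2 - LaurentPolynomial.T (-2)) ^ (D.numCircles s - 1)
  else 0

/-- The circle factor is symmetric under `A ↔ A⁻¹`, and `a(s) - b(s)` changes sign; this reduces
lowest degrees to highest ones. -/
theorem bracketAt_false [Fintype C] :
    D.bracketAt false = LaurentPolynomial.invert D.bracket := by
  rw [bracketAt, bracket, map_sum]
  refine Finset.sum_congr rfl fun s _ => ?_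
  rw [apply_ite (LaurentPolynomial.invert), map_mul, map_pow, map_sub, map_neg, map_zero,
    LaurentPolynomial.invert_T, LaurentPolynomial.invert_T, LaurentPolynomial.invert_T, neg_neg,
    ← Finset.sum_neg_distrib]
  congr 2
  · congr 1
    refine Finset.sum_congr rfl fun i _ => ?_
    cases s i <;> simp
  · ring

theorem off_bijective [Finite C] (b : Bool) :
    Function.Bijective (off b : Finset C → KauffmanState C) := by
  classical
  have := Fintype.ofFinite C
  constructor
  · intro S T h
    ext i
    have := congrFun h i
    by_cases hS : i ∈ S <;> by_cases hT : i ∈ T <;> simp_all [off]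
  · intro s
    refine ⟨Finset.univ.filter fun i => s i ≠ b, ?_⟩
    funext i
    by_cases h : s i = b
    · simp [off, h]
    · simp only [off, ne_eq, Finset.mem_filter, Finset.mem_univ, true_and, h, not_false_eq_true,
        if_true]
      cases hs : s i <;> cases b <;> simp_all

theorem sum_off [Fintype C] (b : Bool) (S : Finset C) :
    (∑ i, if off b S i = b then (1 : ℤ) else -1) = Fintype.card C - 2 * S.card := by
  classical
  have h : ∀ i, (if off b S i = b then (1 : ℤ) else -1) = 1 - 2 * if i ∈ S then 1 else 0 := by
    intro i
    by_cases hi : i ∈ S <;> simp [off, hi]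
  rw [Finset.sum_congr rfl fun i _ => h i, Finset.sum_sub_distrib, ← Finset.mul_sum]
  simp

open Classical in
theorem coeff_bracketAt [Fintype C] (r : ℤ) :
    (D.bracketAt b).coeff r = ∑ S : Finset C, if D.AllContractible (off b S) then
      ((-LaurentPolynomial.T 2 - LaurentPolynomial.T (-2) : ℤ[T;T⁻¹]) ^
        (D.numCircles (off b S) - 1)).coeff (r - (Fintype.card C - 2 * S.card)) else 0 := by
  rw [bracketAt, ← (off_bijective b).sum_comp, AddMonoidAlgebra.coeff_sum, Finsupp.finsetSum_apply]
  refine Finset.sum_congr rfl fun S _ => ?_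
  split_ifs
  · rw [LaurentPolynomial.coeff_T_mul, sum_off]
  · rfl

variable (D b) in
/-- The highest degree of the bracket of an adequate diagram. -/
def topDegree [Fintype C] : ℤ := Fintype.card C + 2 * D.numCircles (const C b) - 2

open Classical in
theorem coeff_bracketAt_term [Fintype C] [Finite P] (hne : Nonempty D.HalfEdge)
    (h : D.GeometricallyAdequate (const C b)) {S : Finset C} (hS : S.Nonempty) {r : ℤ}
    (hr : D.topDegree b - 4 ≤ r) :
    (if D.AllContractible (off b S) then
      ((-LaurentPolynomial.T 2 - LaurentPolynomial.T (-2) : ℤ[T;T⁻¹]) ^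
        (D.numCircles (off b S) - 1)).coeff (r - (Fintype.card C - 2 * S.card)) else 0) =
    if r = D.topDegree b - 4 then
      (-1) ^ (D.numCircles (const C b) - 1) * (if D.IsExtremal b S then (-1) ^ S.card else 0)
    else 0 := by
  have hle := numCircles_off_le h hS
  have hpos := numCircles_pos hne (off b S)
  have hpos' := numCircles_pos hne (const C b)
  rw [topDegree] at *
  by_cases hc : D.AllContractible (off b S)
  · rw [if_pos hc]
    by_cases hN : D.numCircles (off b S) + 2 = D.numCircles (const C b) + S.card
    · rw [if_pos (show D.IsExtremal b S from ⟨hc, hN⟩)]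
      split_ifs with hr'
      · have he : r - (Fintype.card C - 2 * S.card) =
            2 * ((D.numCircles (off b S) - 1 : ℕ) : ℤ) := by omega
        -- In the extremal case `|s|` has the parity of `|s_b| + |S|`, `s_b` being the constant
        -- state; this gives the sign `(-1)^|S|` relative to the leading term.
        rw [he, LaurentPolynomial.coeff_circleFactor_pow_top, ← pow_add,
          neg_one_pow_congr (m := D.numCircles (off b S) - 1)
            (n := D.numCircles (const C b) - 1 + S.card)]
        rw [show D.numCircles (const C b) - 1 + S.card = D.numCircles (off b S) - 1 + 2 by omega]
        simp [Nat.even_add]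
      · exact LaurentPolynomial.coeff_circleFactor_pow_of_lt (by omega)
    · rw [if_neg (fun hx : D.IsExtremal b S => hN hx.2), mul_zero, ite_self]
      exact LaurentPolynomial.coeff_circleFactor_pow_of_lt (by omega)
  · rw [if_neg hc, if_neg (fun hx : D.IsExtremal b S => hc hx.1), mul_zero, ite_self]

open Classical in
theorem coeff_bracketAt_of_le [Fintype C] [Finite P] (hne : Nonempty D.HalfEdge)
    (h : D.GeometricallyAdequate (const C b)) {r : ℤ} (hr : D.topDegree b - 4 ≤ r) :
    (D.bracketAt b).coeff r =
      ((-LaurentPolynomial.T 2 - LaurentPolynomial.T (-2) : ℤ[T;T⁻¹]) ^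
        (D.numCircles (const C b) - 1)).coeff (r - Fintype.card C) +
      if r = D.topDegree b - 4 then (-1) ^ (D.numCircles (const C b) - 1) *
        ∑ S : Finset C, (if S.Nonempty ∧ D.IsExtremal b S then (-1) ^ S.card else 0)
      else 0 := by
  rw [coeff_bracketAt, ← Finset.add_sum_erase _ _ (Finset.mem_univ (∅ : Finset C)), off_empty,
    if_pos h.1, Finset.card_empty, Nat.cast_zero, mul_zero, sub_zero]
  congr 1
  have hite : ∀ (p : Prop) [Decidable p] (s : Finset (Finset C)) (g : Finset C → ℤ),
      (∑ S ∈ s, if p then g S else 0) = if p then ∑ S ∈ s, g S else 0 := by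
    intro p _ s g
    split_ifs <;> simp
  rw [← Finset.add_sum_erase _ _ (Finset.mem_univ (∅ : Finset C)),
    if_neg (fun h : Finset.Nonempty ∅ ∧ _ => Finset.not_nonempty_empty h.1), zero_add,
    Finset.mul_sum, ← hite]
  refine Finset.sum_congr rfl fun S hS => ?_
  have hS' : S.Nonempty := Finset.nonempty_iff_ne_empty.mpr (Finset.ne_of_mem_erase hS)
  rw [coeff_bracketAt_term hne h hS' hr]
  simp [hS']

theorem coeff_bracketAt_of_lt [Fintype C] [Finite P] (hne : Nonempty D.HalfEdge)
    (h : D.GeometricallyAdequate (const C b)) {r : ℤ} (hr : D.topDegree b < r) :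
    (D.bracketAt b).coeff r = 0 := by
  rw [coeff_bracketAt_of_le hne h (by omega), if_neg (by omega), add_zero]
  have := numCircles_pos hne (const C b)
  rw [topDegree] at hr
  exact LaurentPolynomial.coeff_circleFactor_pow_of_lt (by omega)

theorem coeff_bracketAt_topDegree [Fintype C] [Finite P] (hne : Nonempty D.HalfEdge)
    (h : D.GeometricallyAdequate (const C b)) :
    (D.bracketAt b).coeff (D.topDegree b) = (-1) ^ (D.numCircles (const C b) - 1) := by
  have := numCircles_pos hne (const C b)
  rw [coeff_bracketAt_of_le hne h (by omega), if_neg (by omega), add_zero,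
    ← LaurentPolynomial.coeff_circleFactor_pow_top]
  congr 1
  rw [topDegree]
  omega

theorem coeff_bracketAt_topDegree_sub [Fintype H] [Fintype C] [Finite P]
    (hne : Nonempty D.HalfEdge) (h : D.GeometricallyAdequate (const C b)) :
    (D.bracketAt b).coeff (D.topDegree b - 4) = (-1) ^ (D.numCircles (const C b) - 1) *
      (D.numCircles (const C b) - 1 - D.numReducedEdges (const C b)) := by
  classical
  have hpos := numCircles_pos hne (const C b)
  have hdeg : D.topDegree b - 4 - Fintype.card C =
      2 * ((D.numCircles (const C b) - 1 : ℕ) : ℤ) - 4 := by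
    rw [topDegree]
    omega
  rw [coeff_bracketAt_of_le hne h le_rfl, if_pos rfl, hdeg,
    LaurentPolynomial.coeff_circleFactor_pow_next, ← mul_add, Nat.cast_sub hpos, Nat.cast_one,
    numReducedEdges, sub_eq_add_neg _ (Nat.card (Quot _) : ℤ),
    ← h.equivalence_parallel.sum_neg_one_pow_card]
  congr 2
  refine Finset.sum_congr rfl fun S _ => if_congr (and_congr_right fun hS => ?_) rfl rfl
  exact ⟨fun hx i hi j hj => hx.parallel h hi hj, fun hp => isExtremal_of_parallel h hS hp⟩

/-- The reduced state graph of a connected adequate diagram is connected. -/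
theorem numCircles_le_of_connected [Finite C] [Finite P] {s : KauffmanState C}
    (h : D.GeometricallyAdequate s) (hconn : D.Connected) :
    D.numCircles s ≤ D.numReducedEdges s + 1 := by
  let G : SimpleGraph (D.Circle s) := SimpleGraph.fromEdgeSet (Set.range (D.ends s))
  have hcross : ∀ i k l,
      G.Reachable (D.circle s (Sum.inl (i, k))) (D.circle s (Sum.inl (i, l))) := by
    intro i k l
    by_cases hkl : D.circle s (Sum.inl (i, k)) = D.circle s (Sum.inl (i, l))
    · rw [hkl]
    · exact SimpleGraph.Adj.reachable
        ((SimpleGraph.fromEdgeSet_adj _).mpr ⟨⟨i, ends_eq_of_circle_ne hkl⟩, hkl⟩)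
  have hreach : ∀ x y, Relation.EqvGen (fun u v => v = D.mate u ∨ D.vertex u = D.vertex v) x y →
      G.Reachable (D.circle s x) (D.circle s y) := by
    intro x y hxy
    induction hxy with
    | rel x y h =>
      rcases h with rfl | h
      · rw [circle_mate]
      · rcases x with ⟨i, k⟩ | ⟨p, k⟩ <;> rcases y with ⟨j, l⟩ | ⟨q, l⟩ <;>
          simp only [vertex, Sum.map_inl, Sum.map_inr, Sum.inl.injEq, Sum.inr.injEq,
            reduceCtorEq] at h
        · subst h
          exact hcross _ _ _
        · subst h
          rcases (by decide : ∀ k l : ZMod 2, l = k ∨ l = k + 1) k l with rfl | rfl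
          · exact SimpleGraph.Reachable.refl _
          · rw [show (Sum.inr (p, k + 1) : D.HalfEdge) = D.turn s (Sum.inr (p, k)) from rfl,
              circle_turn]
    | refl x => exact SimpleGraph.Reachable.refl _
    | symm x y _ ih => exact ih.symm
    | trans x y z _ _ ih ih' => exact ih.trans ih'
  have hG : G.Connected := by
    have : Nonempty (D.Circle s) := hconn.1.map (D.circle s)
    refine ⟨fun c d => ?_⟩
    obtain ⟨x, rfl⟩ := D.circle_surjective s c
    obtain ⟨y, rfl⟩ := D.circle_surjective s d
    exact hreach x y (hconn.2 x y)
  refine hG.card_vert_le_card_edgeSet_add_one.trans (Nat.add_le_add_right ?_ 1)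
  -- Parallel crossings have the same ends, so a choice of one crossing for each edge of the simple
  -- graph `G` injects the edges into the parallel classes.
  have hex : ∀ e : G.edgeSet, ∃ i, D.ends s i = e.1 := by
    rintro ⟨e, he⟩
    rw [SimpleGraph.edgeSet_fromEdgeSet] at he
    exact he.1
  choose f hf using hex
  have hends : ∀ i j, D.Parallel s i j → D.ends s i = D.ends s j := by
    intro i j hij
    obtain ⟨φ, hφ, hi⟩ := h.exists_isConstAt i
    exact ((parallel_iff hφ (h.not_isLoop i) hi).mp hij).1
  refine Nat.card_le_card_of_injective (fun e => Quot.mk (D.Parallel s) (f e)) fun e e' hee => ?_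
  have := congrArg (Quot.lift (D.ends s) hends) hee
  exact Subtype.ext ((hf e).symm.trans (this.trans (hf e')))

/-- The writhe normalisation is multiplication by a unit `±A^k`: it shifts degrees and keeps
absolute values. -/
theorem exists_coeff_eq [Fintype C] {J : ℤ[T;T⁻¹]}
    (hJ : J = D.bracket ∨ ∃ o : D.Orientation, J = D.jones o) :
    ∃ u k : ℤ, |u| = 1 ∧ ∀ r, J.coeff r = u * D.bracket.coeff (r - k) := by
  rcases hJ with rfl | ⟨o, rfl⟩
  · exact ⟨1, 0, abs_one, fun r => by rw [one_mul, sub_zero]⟩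
  · refine ⟨(D.writhe o).negOnePow, -3 * D.writhe o, Int.abs_negOnePow _, fun r => ?_⟩
    rw [jones, mul_assoc, LaurentPolynomial.coeff_C_mul, LaurentPolynomial.coeff_T_mul]

/-- The two extreme coefficients, for either constant state. -/
theorem GeometricallyAdequate.coeff [Fintype H] [Fintype C] [Finite P]
    (hne : Nonempty D.HalfEdge) (h : D.GeometricallyAdequate (const C b)) {u : ℤ} (hu : |u| = 1) :
    (∀ r, u * (D.bracketAt b).coeff r ≠ 0 → r ≤ D.topDegree b) ∧
      |u * (D.bracketAt b).coeff (D.topDegree b)| = 1 ∧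
      |u * (D.bracketAt b).coeff (D.topDegree b - 4)| =
        |(D.numReducedEdges (const C b) : ℤ) - D.numCircles (const C b) + 1| ∧
      (D.Connected → |u * (D.bracketAt b).coeff (D.topDegree b - 4)| =
        (D.numReducedEdges (const C b) : ℤ) - D.numCircles (const C b) + 1) := by
  have hnext : |u * (D.bracketAt b).coeff (D.topDegree b - 4)| =
      |(D.numReducedEdges (const C b) : ℤ) - D.numCircles (const C b) + 1| := by
    rw [coeff_bracketAt_topDegree_sub hne h, abs_mul, abs_mul, hu, abs_neg_one_pow, one_mul,
      one_mul, ← abs_neg]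
    congr 1
    ring
  refine ⟨fun r hr => ?_, ?_, hnext, fun hconn => ?_⟩
  · by_contra hlt
    exact hr (by rw [coeff_bracketAt_of_lt hne h (not_le.mp hlt), mul_zero])
  · rw [coeff_bracketAt_topDegree hne h, abs_mul, hu, abs_neg_one_pow, one_mul]
  · rw [hnext, abs_of_nonneg]
    have := numCircles_le_of_connected h hconn
    omega

end LinkDiagram

theorem theorem2 {H C P : Type*} [Fintype H] [Fintype C] [Fintype P]
    (F : ClosedSurface H) (D : LinkDiagram F C P) (hD : Nonempty D.HalfEdge)
    (J : ℤ[T;T⁻¹]) (hJ : J = D.bracket ∨ ∃ o : D.Orientation, J = D.jones o) :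
    (D.GeometricallyAdequate D.stateA →
      ∃ m : ℤ, IsGreatest {r : ℤ | J.coeff r ≠ 0} m ∧
        |J.coeff m| = 1 ∧
        |J.coeff (m - 4)| = |(D.numReducedEdges D.stateA : ℤ) - D.numCircles D.stateA + 1| ∧
        (D.Connected →
          |J.coeff (m - 4)| = (D.numReducedEdges D.stateA : ℤ) - D.numCircles D.stateA + 1)) ∧
    (D.GeometricallyAdequate D.stateB →
      ∃ n : ℤ, IsLeast {r : ℤ | J.coeff r ≠ 0} n ∧
        |J.coeff n| = 1 ∧
        |J.coeff (n + 4)| = |(D.numReducedEdges D.stateB : ℤ) - D.numCircles D.stateB + 1| ∧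
        (D.Connected →
          |J.coeff (n + 4)| = (D.numReducedEdges D.stateB : ℤ) - D.numCircles D.stateB + 1)) := by
  obtain ⟨u, k, hu, hcoeff⟩ := LinkDiagram.exists_coeff_eq hJ
  constructor
  · intro h
    obtain ⟨h1, h2, h3, h4⟩ := LinkDiagram.GeometricallyAdequate.coeff (b := true) hD h hu
    have hJ' : ∀ r, J.coeff r = u * (D.bracketAt true).coeff (r - k) := hcoeff
    have e1 : D.topDegree true + k - k = D.topDegree true := by ring
    have e2 : D.topDegree true + k - 4 - k = D.topDegree true - 4 := by ring
    refine ⟨D.topDegree true + k, ⟨?_, fun r hr => ?_⟩, ?_, ?_, ?_⟩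
    · intro h0
      rw [hJ', e1] at h0
      rw [h0] at h2
      exact absurd h2 (by decide)
    · rw [Set.mem_ofPred_eq, hJ'] at hr
      linarith [h1 _ hr]
    · rw [hJ', e1]; exact h2
    · rw [hJ', e2]; exact h3
    · rw [hJ', e2]; exact h4
  · intro h
    obtain ⟨h1, h2, h3, h4⟩ := LinkDiagram.GeometricallyAdequate.coeff (b := false) hD h hu
    have hJ' : ∀ r, J.coeff r = u * (D.bracketAt false).coeff (k - r) := fun r => by
      rw [hcoeff, LinkDiagram.bracketAt_false, LaurentPolynomial.invert_apply, neg_sub]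
    have e1 : k - (k - D.topDegree false) = D.topDegree false := by ring
    have e2 : k - (k - D.topDegree false + 4) = D.topDegree false - 4 := by ring
    -- Inversion of `A` reverses degrees, so the top degree for `b = false` becomes the lowest
    -- degree of `J`.
    refine ⟨k - D.topDegree false, ⟨?_, fun r hr => ?_⟩, ?_, ?_, ?_⟩
    · intro h0
      rw [hJ', e1] at h0
      rw [h0] at h2
      exact absurd h2 (by decide)
    · rw [Set.mem_ofPred_eq, hJ'] at hr
      linarith [h1 _ hr]
    · rw [hJ', e1]; exact h2
    · rw [hJ', e2]; exact h3
    · rw [hJ', e2]; exact h4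

end
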